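/- **Setting.** For each $n$ let $(\Omega_n,P_n)$ be a probability space, let $p_n\ge 1$ and let $m$ be a fixed cluster size. For clusters $i=1,\dots,n$ let $X_i$ be a fixed real $m\times p_n$ matrix with rows $X_{ij}^T$ (dependence on $n$ is suppressed), and let $Y_i=(Y_{i1},\dots,Y_{im})^T$ be a random vector with entries in $\{0,1\}$; $Y_1,\dots,Y_n$ are independent. For $\beta\in\mathbb R^{p_n}$ put $\pi_{ij}(\beta)=e^{X_{ij}^T\beta}/(1+e^{X_{ij}^T\beta})$, $\pi_i(\beta)=(\pi_{ij}(\beta))_j$, $A_i(\beta)=\mathrm{diag}_j\big(\pi_{ij}(\beta)(1-\pi_{ij}(\beta))\big)$ and $\varepsilon_i(\beta)=A_i^{-1/2}(\beta)(Y_i-\pi_i(\beta))$. The true parameter $\beta_{n0}\in\mathbb R^{p_n}$ satisfies $E\,Y_{ij}=\pi_{ij}(\beta_{n0})$, and all $Y_i$ have the same correlation matrix $R_0$. Let $\widehat R$ be a random real $m\times m$ matrix (the estimated working correlation matrix) and $\overline R$ a nonrandom positive definite $m\times m$ matrix; $R_0$ and $\overline R$ may depend on $n$. $\|\cdot\|$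 is the Euclidean norm of a vector and the Frobenius norm of a matrix. Let $$S_n(\beta)=\sum_{i=1}^n X_i^TA_i^{1/2}(\beta)\widehat R^{-1}A_i^{-1/2}(\beta)(Y_i-\pi_i(\beta)),$$ $$\overline H_n(\beta)=\sum_{i=1}^n X_i^TA_i^{1/2}(\beta)\overline R^{-1}A_i^{1/2}(\beta)X_i,\qquad \overline M_n(\beta)=\sum_{i=1}^n X_i^TA_i^{1/2}(\beta)\overline R^{-1}R_0\overline R^{-1}A_i^{1/2}(\beta)X_i,$$ let $H_n(\beta)$ be $\overline H_n(\beta)$ with $\overline R$ replaced by $\widehat R$, and $$\widehat M_n(\beta)=\sum_{i=1}^n X_i^TA_i^{1/2}(\beta)\widehat R^{-1}\varepsilon_i(\beta)\varepsilon_i^T(\beta)\widehat R^{-1}A_i^{1/2}(\beta)X_i.$$ **Assumptions.** The bounds below are required for all sufficiently large $n$, with constants not depending on $n$. * (A1) $\sup_{i,j}\|X_{ij}\|=O(\sqrt{p_n})$. * (A2) $\beta_{n0}$ lies in the interior of a compact parameter set $\mathcal B_n\subseteq\mathbb R^{p_n}$, and there are constants $b_1,b_2$ with $0<b_1\le\pi_{ij}(\beta_{n0})\le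 b_2<1$ for all $i,j$. * (A3) There are constants $b_3,b_4>0$ such that all eigenvalues of $n^{-1}\sum_{i=1}^nX_i^TX_i$ lie in $[b_3,b_4]$. * (A4) The eigenvalues of $R_0$ and of $\overline R$ are bounded away from $0$ and $+\infty$, and $\|\widehat R^{-1}-\overline R^{-1}\|=O_p(\sqrt{p_n/n})$. Assume moreover $p_n^3/n\to0$ as $n\to\infty$. **Theorem.** A sequence of random vectors $\widehat\beta_n\in\mathbb R^{p_n}$ is called a GEE estimator if $P_n(S_n(\widehat\beta_n)=0)\to1$ and $\|\widehat\beta_n-\beta_{n0}\|=O_p(\sqrt{p_n/n})$. Then a GEE estimator exists; $\overline H_n(\beta_{n0})$ is invertible for all large $n$; and for every GEE estimator $\widehat\beta_n$ the matrix $H_n(\widehat\beta_n)$ is invertible with probability tending to $1$ and, with $$\widehat\Sigma_n=H_n^{-1}(\widehat\beta_n)\widehat M_n(\widehat\beta_n)H_n^{-1}(\widehat\beta_n),\qquad \Sigma_n=\overline H_n^{-1}(\beta_{n0})\overline M_n(\beta_{n0})\overline H_n^{-1}(\beta_{n0}),$$ one has $$C_n\widehat\Sigma_nC_n^T-C_n\Sigma_nC_n^T=o_p(n^{-1})$$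 for every fixed $l$, every fixed positive definite $l\times l$ matrix $G$ and every sequence of $l\times p_n$ matrices $C_n$ with $C_nC_n^T=G$ for all large $n$. -/

import Mathlib

open MeasureTheory ProbabilityTheory Filter Topology
open scoped Matrix

noncomputable section

namespace GEE

/-! ### Stochastic order symbols -/

/-- `Z n = O_p(r n)`. The probability space may change with `n`. -/
def IsBigOp {Ω : ℕ → Type*} [∀ n, MeasurableSpace (Ω n)] (P : ∀ n, Measure (Ω n))
    (Z : ∀ n, Ω n → ℝ) (r : ℕ → ℝ) : Prop :=
  ∀ ε : ℝ, 0 < ε → ∃ K : ℝ, 0 < K ∧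
    ∀ᶠ n in atTop, P n {ω | K * r n < |Z n ω|} ≤ ENNReal.ofReal ε

/-- `Z n = o_p(r n)`. The probability space may change with `n`. -/
def IsLittleOp {Ω : ℕ → Type*} [∀ n, MeasurableSpace (Ω n)] (P : ∀ n, Measure (Ω n))
    (Z : ∀ n, Ω n → ℝ) (r : ℕ → ℝ) : Prop :=
  ∀ ε : ℝ, 0 < ε → Tendsto (fun n => P n {ω | ε * r n < |Z n ω|}) atTop (𝓝 0)

/-- The Frobenius norm `[Tr (B Bᵀ)]^{1/2}`. -/
def frobNorm {k l : ℕ} (B : Matrix (Fin k) (Fin l) ℝ) : ℝ :=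
  Real.sqrt (B * Bᵀ).trace

/-! ### The marginal logistic model of one cluster -/

section Cluster

variable {m p : ℕ}

/-- The marginal success probability `π_j(β) = exp(x_jᵀ β) / (1 + exp(x_jᵀ β))`, where `x_jᵀ` is
the `j`-th row of the covariate matrix `X` of the cluster. -/
def prob (X : Matrix (Fin m) (Fin p) ℝ) (β : EuclideanSpace ℝ (Fin p)) (j : Fin m) : ℝ :=
  Real.exp ((X *ᵥ β.ofLp) j) / (1 + Real.exp ((X *ᵥ β.ofLp) j))

/-- The marginal variance `A_j(β) = π_j(β) (1 - π_j(β))`. -/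
def margVar (X : Matrix (Fin m) (Fin p) ℝ) (β : EuclideanSpace ℝ (Fin p)) (j : Fin m) : ℝ :=
  prob X β j * (1 - prob X β j)

/-- `A(β)^{1/2}`, where `A(β)` is the diagonal matrix of the marginal variances. -/
def sqrtA (X : Matrix (Fin m) (Fin p) ℝ) (β : EuclideanSpace ℝ (Fin p)) :
    Matrix (Fin m) (Fin m) ℝ :=
  Matrix.diagonal fun j => Real.sqrt (margVar X β j)

/-- `A(β)^{-1/2}`. -/
def invSqrtA (X : Matrix (Fin m) (Fin p) ℝ) (β : EuclideanSpace ℝ (Fin p)) :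
    Matrix (Fin m) (Fin m) ℝ :=
  Matrix.diagonal fun j => (Real.sqrt (margVar X β j))⁻¹

/-- The standardized residual vector `ε(β) = A(β)^{-1/2} (Y - π(β))`. -/
def resid (X : Matrix (Fin m) (Fin p) ℝ) (Y : Fin m → ℝ) (β : EuclideanSpace ℝ (Fin p)) :
    Fin m → ℝ :=
  invSqrtA X β *ᵥ (Y - prob X β)

end Cluster

/-! ### Estimating function and sandwich matrices of a sample of `n` clusters -/

section Sample

variable {n m p : ℕ}

/-- The generalized estimating function with working correlation matrix `R`:
`∑ i, X_iᵀ A_i^{1/2}(β) R⁻¹ A_i^{-1/2}(β) (Y_i - π_i(β))`. -/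
def estFun (R : Matrix (Fin m) (Fin m) ℝ) (X : Fin n → Matrix (Fin m) (Fin p) ℝ)
    (Y : Fin n → Fin m → ℝ) (β : EuclideanSpace ℝ (Fin p)) : Fin p → ℝ :=
  ∑ i, ((X i)ᵀ * sqrtA (X i) β * R⁻¹ * invSqrtA (X i) β) *ᵥ (Y i - prob (X i) β)

/-- `H(β) = ∑ i, X_iᵀ A_i^{1/2}(β) R⁻¹ A_i^{1/2}(β) X_i`. -/
def matH (R : Matrix (Fin m) (Fin m) ℝ) (X : Fin n → Matrix (Fin m) (Fin p) ℝ)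
    (β : EuclideanSpace ℝ (Fin p)) : Matrix (Fin p) (Fin p) ℝ :=
  ∑ i, (X i)ᵀ * sqrtA (X i) β * R⁻¹ * sqrtA (X i) β * X i

/-- `∑ i, X_iᵀ A_i^{1/2}(β) R⁻¹ T_i R⁻¹ A_i^{1/2}(β) X_i` for inner matrices `T_i`. -/
def matM (R : Matrix (Fin m) (Fin m) ℝ) (T : Fin n → Matrix (Fin m) (Fin m) ℝ)
    (X : Fin n → Matrix (Fin m) (Fin p) ℝ) (β : EuclideanSpace ℝ (Fin p)) :
    Matrix (Fin p) (Fin p) ℝ :=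
  ∑ i, (X i)ᵀ * sqrtA (X i) β * R⁻¹ * T i * R⁻¹ * sqrtA (X i) β * X i

/-- The asymptotic covariance matrix `H⁻¹ M H⁻¹` with the true common correlation matrix `R₀`
inside `M`. -/
def sigma (R R₀ : Matrix (Fin m) (Fin m) ℝ) (X : Fin n → Matrix (Fin m) (Fin p) ℝ)
    (β : EuclideanSpace ℝ (Fin p)) : Matrix (Fin p) (Fin p) ℝ :=
  (matH R X β)⁻¹ * matM R (fun _ => R₀) X β * (matH R X β)⁻¹

/-- The sandwich covariance estimator `H⁻¹ M̂ H⁻¹`: the true correlation matrix is replaced by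
`ε_i(β) ε_i(β)ᵀ`. -/
def sigmaHat (R : Matrix (Fin m) (Fin m) ℝ) (X : Fin n → Matrix (Fin m) (Fin p) ℝ)
    (Y : Fin n → Fin m → ℝ) (β : EuclideanSpace ℝ (Fin p)) : Matrix (Fin p) (Fin p) ℝ :=
  (matH R X β)⁻¹
    * matM R (fun i => Matrix.vecMulVec (resid (X i) (Y i) β) (resid (X i) (Y i) β)) X β
    * (matH R X β)⁻¹

end Sample

/-- `βhat` is a (consistent) GEE estimator: a sequence of random vectors which solve the
generalized estimating equation with probability tending to one and satisfy
`‖βhat n - β₀ n‖ = O_p(√(p n / n))`. -/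
structure IsGEEEstimator {Ω : ℕ → Type*} [∀ n, MeasurableSpace (Ω n)] (P : ∀ n, Measure (Ω n))
    {m : ℕ} {p : ℕ → ℕ} (X : ∀ n, Fin n → Matrix (Fin m) (Fin (p n)) ℝ)
    (Y : ∀ n, Ω n → Fin n → Fin m → ℝ) (Rhat : ∀ n, Ω n → Matrix (Fin m) (Fin m) ℝ)
    (β₀ : ∀ n, EuclideanSpace ℝ (Fin (p n)))
    (βhat : ∀ n, Ω n → EuclideanSpace ℝ (Fin (p n))) : Prop where
  measurable : ∀ n, Measurable (βhat n)
  root : Tendsto (fun n => P n {ω | estFun (Rhat n ω) (X n) (Y n ω) (βhat n ω) = 0}) atTop (𝓝 1)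
  rate : IsBigOp P (fun n ω => ‖βhat n ω - β₀ n‖) (fun n => Real.sqrt ((p n : ℝ) / n))

end GEE

end

/-!
The proof is a perturbation argument in operator norm. The growth condition enters through
`p / √n → 0`.

*Reduction to weights.* In the linear predictors `θ = X β` the marginal standard deviation is
`sd θ = 1 / (exp (θ / 2) + exp (-θ / 2))`, and the standardized residual of a response `y` is
`y exp (-θ / 2) - (1 - y) exp (θ / 2)`. Hence the estimating function is a sum of `Xᵢᵀ u`, and the
matrices of the sandwich are sums of `Xᵢᵀ V Xᵢ`, with `u` and `V` fixed smooth functions of the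
linear predictors, the inverse working correlation and the responses. Near the true parameter these
arguments stay in a compact set: `|Xᵢⱼᵀ (β - β₀)|` is at most a constant times `√p ‖β - β₀‖`. So
uniform continuity makes the weights uniformly close to their values at the true parameter
(`exists_forall_abs_sub_le`), and weights bounded by `δ` contribute at most a multiple of `δ n` in
operator norm, whatever `p` is, because the Gram matrix of the design has eigenvalues of order `n`
(`norm_sum_transpose_mulVec_le`, `norm_sum_weighted_le`).

*Fluctuations at the true parameter.* There the weights are independent, and minus their means they
are centred and bounded. By Chebyshev's inequality in Frobenius norm the centred sums of
`Xᵢᵀ V Xᵢ` are `O_p(p √n) = o_p(n)` (`highProb_norm_weighted_sub_mean`), and the estimating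
function is `O_p(√(n p))` (`isBigOp_norm_estFun`). The means are the right ones: the expected
Jacobian of the estimating function is `-H`, and the residuals have second moment matrix `R₀`.

*Existence.* The two facts together say that `β ↦ β + H⁻¹ S(β)`, with `H` frozen at the true
parameter, is a contraction with constant `1 / 2` on a ball of radius of order `1 / √p` about the
true parameter, with probability tending to one (`exists_newton_convergence`). Its fixed point is a
root at distance at most a constant times `‖S(β₀)‖ / n = O_p(√(p / n))`. The iterates are
measurable, so their limit is too, and no measurable selection theorem is needed
(`exists_isGEEEstimator`).

*Sandwich.* With probability tending to one `H`, at an estimator with the rate `√(p / n)`, is within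
`o(n)` of a matrix which is coercive with constant of order `n`, and the middle matrix is within
`o(n)` of its target. Hence the sandwich is within `o(n⁻¹)` of its target in operator norm
(`exists_sandwich_stability`, `highProb_norm_sigmaHat_sub`), and conjugation by `C` costs only the
factor `tr (C Cᵀ) = tr G` (`frobNorm_conj_le`).
-/

noncomputable section

namespace GEE

/-! ### The logistic model in closed form -/

/-- The marginal standard deviation as a function of the linear predictor. -/
def sd (s : ℝ) : ℝ := (Real.exp (s / 2) + Real.exp (-(s / 2)))⁻¹

/-- The derivative of `sd`. -/
def sdDeriv (s : ℝ) : ℝ :=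
  -(1 / 2) * (Real.exp (s / 2) - Real.exp (-(s / 2))) * sd s ^ 2

/-- The standardized residual of a response `y` as a function of the linear predictor `t`. -/
def res (t y : ℝ) : ℝ := y * Real.exp (-(t / 2)) - (1 - y) * Real.exp (t / 2)

/-- The derivative of `res` in the linear predictor. -/
def resDeriv (t y : ℝ) : ℝ :=
  -(1 / 2) * (y * Real.exp (-(t / 2)) + (1 - y) * Real.exp (t / 2))

lemma sd_pos (s : ℝ) : 0 < sd s := by unfold sd; positivity

lemma continuous_sd : Continuous sd := by
  unfold sd
  exact Continuous.inv₀ (by fun_prop) fun s => by positivity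

lemma continuous_sdDeriv : Continuous sdDeriv := by
  have := continuous_sd
  unfold sdDeriv
  fun_prop

lemma hasDerivAt_sd (s : ℝ) : HasDerivAt sd (sdDeriv s) s := by
  have h1 : HasDerivAt (fun s : ℝ => Real.exp (s / 2)) (Real.exp (s / 2) * (1 / 2)) s :=
    ((hasDerivAt_id s).div_const 2).exp
  have h2 : HasDerivAt (fun s : ℝ => Real.exp (-(s / 2))) (Real.exp (-(s / 2)) * (-(1 / 2))) s :=
    ((hasDerivAt_id s).div_const 2).neg.exp
  have h3 := (h1.add h2).fun_inv (by simp only [Pi.add_apply]; positivity)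
  convert! h3 using 1
  simp only [sdDeriv, sd, Pi.add_apply]
  field_simp
  ring

lemma hasDerivAt_res (t y : ℝ) : HasDerivAt (fun t => res t y) (resDeriv t y) t := by
  have h1 : HasDerivAt (fun s : ℝ => Real.exp (s / 2)) (Real.exp (t / 2) * (1 / 2)) t :=
    ((hasDerivAt_id t).div_const 2).exp
  have h2 : HasDerivAt (fun s : ℝ => Real.exp (-(s / 2))) (Real.exp (-(t / 2)) * (-(1 / 2))) t :=
    ((hasDerivAt_id t).div_const 2).neg.exp
  convert! (h2.const_mul y).sub (h1.const_mul (1 - y)) using 1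
  simp only [resDeriv]
  ring

lemma exp_half_mul (t : ℝ) : Real.exp (t / 2) * Real.exp (-(t / 2)) = 1 := by
  rw [← Real.exp_add]; simp

lemma exp_half_sq (t : ℝ) : Real.exp t = Real.exp (t / 2) ^ 2 := by
  rw [← Real.exp_nat_mul]; congr 1; push_cast; ring

lemma logistic_eq (t : ℝ) : Real.exp t / (1 + Real.exp t) = Real.exp (t / 2) * sd t := by
  have h := exp_half_mul t
  unfold sd
  rw [exp_half_sq t, ← div_eq_mul_inv, div_eq_div_iff (by positivity) (by positivity)]
  linear_combination Real.exp (t / 2) ^ 1 * h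

lemma one_sub_logistic_eq (t : ℝ) :
    1 - Real.exp t / (1 + Real.exp t) = Real.exp (-(t / 2)) * sd t := by
  rw [logistic_eq]
  unfold sd
  field_simp
  ring

lemma logistic_mul_one_sub (t : ℝ) :
    Real.exp t / (1 + Real.exp t) * (1 - Real.exp t / (1 + Real.exp t)) = sd t ^ 2 := by
  rw [one_sub_logistic_eq, logistic_eq]
  linear_combination sd t ^ 2 * exp_half_mul t

lemma inv_sd_mul_sub (t y : ℝ) :
    (sd t)⁻¹ * (y - Real.exp t / (1 + Real.exp t)) = res t y := by
  rw [logistic_eq]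
  have h := sd_pos t
  have h' : (sd t)⁻¹ = Real.exp (t / 2) + Real.exp (-(t / 2)) := by simp [sd]
  rw [mul_sub, mul_comm (Real.exp _) (sd t), inv_mul_cancel_left₀ h.ne', h', res]
  ring

/-- The residual derivative at a response equal to the success probability is `-sd`. -/
lemma resDeriv_logistic (t : ℝ) : resDeriv t (Real.exp t / (1 + Real.exp t)) = -sd t := by
  rw [resDeriv, one_sub_logistic_eq, logistic_eq]
  linear_combination -sd t * exp_half_mul t

/-- Probabilities bounded away from `0` and `1` come from bounded linear predictors. -/
lemma abs_le_of_logistic {b₁ b₂ t : ℝ} (h0 : 0 < b₁) (h1 : b₂ < 1)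
    (hl : b₁ ≤ Real.exp t / (1 + Real.exp t)) (hu : Real.exp t / (1 + Real.exp t) ≤ b₂) :
    |t| ≤ |Real.log b₁| + |Real.log (1 - b₂)| := by
  have e1 : b₁ ≤ Real.exp t := hl.trans (div_le_self (by positivity) (by
    linarith [Real.exp_pos t]))
  have e2 : 1 - b₂ ≤ Real.exp (-t) := by
    refine (sub_le_sub_left hu 1).trans ?_
    rw [Real.exp_neg, one_sub_div (by positivity), add_sub_cancel_right, ← one_div]
    exact one_div_le_one_div_of_le (by positivity) (by linarith)
  have l1 := Real.log_le_log h0 e1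
  have l2 := Real.log_le_log (sub_pos.2 h1) e2
  rw [Real.log_exp] at l1 l2
  rw [abs_le]
  constructor
  · linarith [neg_abs_le (Real.log b₁), abs_nonneg (Real.log (1 - b₂))]
  · linarith [neg_abs_le (Real.log (1 - b₂)), abs_nonneg (Real.log b₁)]

/-! ### Cluster weights -/

section Weights

variable {m : ℕ}

/-- The contribution of one cluster to the estimating function is `Xᵀ` applied to this vector, which
depends on `β` through the linear predictors `θ` only. `W` is the inverse working correlation. -/
def score (θ : Fin m → ℝ) (W : Matrix (Fin m) (Fin m) ℝ) (y : Fin m → ℝ) (j : Fin m) : ℝ :=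
  sd (θ j) * ∑ k, W j k * res (θ k) (y k)

/-- The Jacobian of `score` in the linear predictors. -/
def scoreDeriv (θ : Fin m → ℝ) (W : Matrix (Fin m) (Fin m) ℝ) (y : Fin m → ℝ) (j k : Fin m) : ℝ :=
  (if j = k then sdDeriv (θ j) * ∑ l, W j l * res (θ l) (y l) else 0)
    + sd (θ j) * (W j k * resDeriv (θ k) (y k))

/-- The matrix `A^{1/2} W A^{1/2}`. -/
def weightH (θ : Fin m → ℝ) (W : Matrix (Fin m) (Fin m) ℝ) (j k : Fin m) : ℝ :=
  sd (θ j) * W j k * sd (θ k)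

/-- The matrix `A^{1/2} W T W A^{1/2}`. -/
def weightM (θ : Fin m → ℝ) (W T : Matrix (Fin m) (Fin m) ℝ) (j k : Fin m) : ℝ :=
  sd (θ j) * (∑ l', (∑ l, W j l * T l l') * W l' k) * sd (θ k)

/-- The outer product of the standardized residual vector with itself. -/
def resOuter (θ y : Fin m → ℝ) : Matrix (Fin m) (Fin m) ℝ :=
  Matrix.of fun l l' => res (θ l) (y l) * res (θ l') (y l')

/-- A continuous function of linear predictors, inverse working correlation and response is, on
bounded sets, insensitive to small changes of the first two, uniformly in everything. -/
lemma exists_forall_abs_sub_le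
    (F : (Fin m → ℝ) → Matrix (Fin m) (Fin m) ℝ → (Fin m → ℝ) → Fin m → Fin m → ℝ)
    (hF : Continuous fun q : (Fin m → ℝ) × (Fin m → Fin m → ℝ) × (Fin m → ℝ) =>
      F q.1 (Matrix.of q.2.1) q.2.2)
    (L κ δ : ℝ) (hδ : 0 < δ) :
    ∃ η, 0 < η ∧ ∀ (θ₀ θ : Fin m → ℝ) (W₀ W : Matrix (Fin m) (Fin m) ℝ) (y : Fin m → ℝ),
      (∀ j, |θ₀ j| ≤ L) → (∀ j k, |W₀ j k| ≤ κ) → (∀ j, |y j| ≤ 1) →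
      (∀ j, |θ j - θ₀ j| ≤ η) → (∀ j k, |W j k - W₀ j k| ≤ η) →
      ∀ j k, |F θ W y j k - F θ₀ W₀ y j k| ≤ δ := by
  have hK : IsCompact ((Set.univ.pi fun _ : Fin m => Set.Icc (-L) L) ×ˢ
      ((Set.univ.pi fun _ : Fin m => Set.univ.pi fun _ : Fin m => Set.Icc (-κ) κ) ×ˢ
        (Set.univ.pi fun _ : Fin m => Set.Icc (-1 : ℝ) 1))) :=
    (isCompact_univ_pi fun _ => isCompact_Icc).prod
      ((isCompact_univ_pi fun _ => isCompact_univ_pi fun _ => isCompact_Icc).prod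
        (isCompact_univ_pi fun _ => isCompact_Icc))
  have h := hK.uniformContinuousAt_of_continuousAt _ (fun a _ => hF.continuousAt)
    (Metric.dist_mem_uniformity hδ)
  obtain ⟨η, hη, h⟩ := Metric.mem_uniformity_dist.1 h
  refine ⟨η / 2, by positivity, fun θ₀ θ W₀ W y h1 h2 h3 h4 h5 j k => ?_⟩
  have hη2 : (0 : ℝ) ≤ η / 2 := by positivity
  have hd : dist (θ₀, Matrix.of.symm W₀, y) (θ, Matrix.of.symm W, y) < η := by
    refine lt_of_le_of_lt ?_ (half_lt_self hη)
    simp only [Prod.dist_eq, dist_self]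
    refine max_le ?_ (max_le ?_ hη2)
    · rw [dist_comm]
      exact (dist_pi_le_iff hη2).2 fun j => by simpa [Real.dist_eq] using h4 j
    · rw [dist_comm]
      exact (dist_pi_le_iff hη2).2 fun j =>
        (dist_pi_le_iff hη2).2 fun k => by simpa [Real.dist_eq] using h5 j k
  have := h hd ⟨fun j _ => abs_le.1 (h1 j), fun j _ k _ => abs_le.1 (h2 j k),
    fun j _ => abs_le.1 (h3 j)⟩
  rw [Set.mem_ofPred_eq, dist_comm] at this
  rw [← Real.dist_eq]
  exact ((dist_le_pi_dist _ _ k).trans (dist_le_pi_dist _ _ j)).trans this.le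

/-- A continuous function of linear predictors, inverse working correlation and response is bounded
on bounded sets. -/
lemma exists_forall_abs_le
    (F : (Fin m → ℝ) → Matrix (Fin m) (Fin m) ℝ → (Fin m → ℝ) → Fin m → Fin m → ℝ)
    (hF : Continuous fun q : (Fin m → ℝ) × (Fin m → Fin m → ℝ) × (Fin m → ℝ) =>
      F q.1 (Matrix.of q.2.1) q.2.2)
    (L κ : ℝ) :
    ∃ c, 0 < c ∧ ∀ (θ : Fin m → ℝ) (W : Matrix (Fin m) (Fin m) ℝ) (y : Fin m → ℝ),
      (∀ j, |θ j| ≤ L) → (∀ j k, |W j k| ≤ κ) → (∀ j, |y j| ≤ 1) →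
      ∀ j k, |F θ W y j k| ≤ c := by
  have hK : IsCompact ((Set.univ.pi fun _ : Fin m => Set.Icc (-L) L) ×ˢ
      ((Set.univ.pi fun _ : Fin m => Set.univ.pi fun _ : Fin m => Set.Icc (-κ) κ) ×ˢ
        (Set.univ.pi fun _ : Fin m => Set.Icc (-1 : ℝ) 1))) :=
    (isCompact_univ_pi fun _ => isCompact_Icc).prod
      ((isCompact_univ_pi fun _ => isCompact_univ_pi fun _ => isCompact_Icc).prod
        (isCompact_univ_pi fun _ => isCompact_Icc))
  obtain ⟨c, hc⟩ := hK.exists_bound_of_continuousOn hF.continuousOn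
  refine ⟨max c 1, by positivity, fun θ W y h1 h2 h3 j k => ?_⟩
  refine le_trans ?_ ((hc (θ, Matrix.of.symm W, y) ⟨fun j _ => abs_le.1 (h1 j), fun j _ k _ => abs_le.1 (h2 j k),
    fun j _ => abs_le.1 (h3 j)⟩).trans (le_max_left _ _))
  rw [← Real.norm_eq_abs]
  exact (norm_le_pi_norm (F θ W y j) k).trans (norm_le_pi_norm (F θ W y) j)

lemma continuous_scoreDeriv :
    Continuous fun q : (Fin m → ℝ) × (Fin m → Fin m → ℝ) × (Fin m → ℝ) =>
      scoreDeriv q.1 (Matrix.of q.2.1) q.2.2 := by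
  have h1 := continuous_sd
  have h2 := continuous_sdDeriv
  unfold scoreDeriv res resDeriv
  refine continuous_pi fun j => continuous_pi fun k => ?_
  split_ifs <;> fun_prop

lemma continuous_weightH :
    Continuous fun q : (Fin m → ℝ) × (Fin m → Fin m → ℝ) × (Fin m → ℝ) =>
      weightH q.1 (Matrix.of q.2.1) := by
  have h1 := continuous_sd
  unfold weightH
  fun_prop

lemma continuous_weightM_resOuter :
    Continuous fun q : (Fin m → ℝ) × (Fin m → Fin m → ℝ) × (Fin m → ℝ) =>
      weightM q.1 (Matrix.of q.2.1) (resOuter q.1 q.2.2) := by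
  have h1 := continuous_sd
  unfold weightM resOuter res
  simp only [Matrix.of_apply]
  fun_prop

lemma hasDerivAt_score_line (θ d : Fin m → ℝ) (W : Matrix (Fin m) (Fin m) ℝ) (y : Fin m → ℝ)
    (j : Fin m) (τ : ℝ) :
    HasDerivAt (fun τ : ℝ => score (θ + τ • d) W y j)
      (∑ k, scoreDeriv (θ + τ • d) W y j k * d k) τ := by
  have hl : ∀ k, HasDerivAt (fun τ : ℝ => (θ + τ • d) k) (d k) τ := fun k => by
    simpa using ((hasDerivAt_id τ).mul_const (d k)).const_add (θ k)
  have h1 : HasDerivAt (fun τ : ℝ => sd ((θ + τ • d) j)) (sdDeriv ((θ + τ • d) j) * d j) τ :=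
    HasDerivAt.comp (h₂ := sd) τ (hasDerivAt_sd ((θ + τ • d) j)) (hl j)
  have h2 : ∀ k, HasDerivAt (fun τ : ℝ => W j k * res ((θ + τ • d) k) (y k))
      (W j k * (resDeriv ((θ + τ • d) k) (y k) * d k)) τ := fun k =>
    (HasDerivAt.comp (h₂ := fun t => res t (y k)) τ
      (hasDerivAt_res ((θ + τ • d) k) (y k)) (hl k)).const_mul (W j k)
  have h3 := h1.fun_mul (HasDerivAt.fun_sum (u := Finset.univ) fun k _ => h2 k)
  refine h3.congr_deriv ?_
  simp only [scoreDeriv, add_mul, Finset.sum_add_distrib, ite_mul, zero_mul,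
    Finset.sum_ite_eq, Finset.mem_univ, if_true]
  congr 1
  · ring
  · rw [Finset.mul_sum]
    exact Finset.sum_congr rfl fun k _ => by ring

/-- Uniform linearization of the cluster score around `θ₀`, `W₀`: the slope may be taken at the
centre at the cost of an arbitrarily small multiple of the increment. -/
lemma exists_score_linearization (L κ δ : ℝ) (hδ : 0 < δ) :
    ∃ η, 0 < η ∧ ∀ (θ₀ θ θ' : Fin m → ℝ) (W₀ W : Matrix (Fin m) (Fin m) ℝ) (y : Fin m → ℝ),
      (∀ j, |θ₀ j| ≤ L) → (∀ j k, |W₀ j k| ≤ κ) → (∀ j, |y j| ≤ 1) →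
      (∀ j, |θ j - θ₀ j| ≤ η) → (∀ j, |θ' j - θ₀ j| ≤ η) → (∀ j k, |W j k - W₀ j k| ≤ η) →
      ∀ j, |score θ W y j - score θ' W y j - ∑ k, scoreDeriv θ₀ W₀ y j k * (θ k - θ' k)|
        ≤ δ * ∑ k, |θ k - θ' k| := by
  obtain ⟨η, hη, h⟩ := exists_forall_abs_sub_le (m := m) _ continuous_scoreDeriv L κ δ hδ
  refine ⟨η, hη, fun θ₀ θ θ' W₀ W y h1 h2 h3 h4 h5 h6 j => ?_⟩
  -- mean value inequality along the segment from `θ'` to `θ`, which stays within `η` of `θ₀`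
  set d : Fin m → ℝ := θ - θ' with hd
  have hder : ∀ τ : ℝ, HasDerivAt (fun τ : ℝ => score (θ' + τ • d) W y j
      - τ * ∑ k, scoreDeriv θ₀ W₀ y j k * d k)
      (∑ k, scoreDeriv (θ' + τ • d) W y j k * d k - ∑ k, scoreDeriv θ₀ W₀ y j k * d k) τ :=
    fun τ => (hasDerivAt_score_line θ' d W y j τ).sub (by
      simpa using (hasDerivAt_id τ).mul_const (∑ k, scoreDeriv θ₀ W₀ y j k * d k))
  have hb : ∀ τ ∈ Set.Ico (0 : ℝ) 1, ‖∑ k, scoreDeriv (θ' + τ • d) W y j k * d k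
      - ∑ k, scoreDeriv θ₀ W₀ y j k * d k‖ ≤ δ * ∑ k, |d k| := by
    intro τ hτ
    rw [← Finset.sum_sub_distrib, Finset.mul_sum]
    refine (norm_sum_le _ _).trans (Finset.sum_le_sum fun k _ => ?_)
    rw [← sub_mul, norm_mul, Real.norm_eq_abs, Real.norm_eq_abs]
    refine mul_le_mul_of_nonneg_right (h θ₀ (θ' + τ • d) W₀ W y h1 h2 h3 (fun i => ?_) h6 j k)
      (abs_nonneg _)
    have e : (θ' + τ • d) i - θ₀ i = (1 - τ) * (θ' i - θ₀ i) + τ * (θ i - θ₀ i) := by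
      simp [hd]; ring
    rw [e]
    calc _ ≤ (1 - τ) * |θ' i - θ₀ i| + τ * |θ i - θ₀ i| := by
          refine (abs_add_le _ _).trans (le_of_eq ?_)
          rw [abs_mul, abs_mul, abs_of_nonneg (sub_nonneg.2 hτ.2.le), abs_of_nonneg hτ.1]
      _ ≤ (1 - τ) * η + τ * η := by
          gcongr
          · exact sub_nonneg.2 hτ.2.le
          · exact h5 i
          · exact hτ.1
          · exact h4 i
      _ = η := by ring
  have := norm_image_sub_le_of_norm_deriv_le_segment_01'
    (fun τ _ => (hder τ).hasDerivWithinAt) hb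
  have e1 : θ' + (1 : ℝ) • d = θ := by simp [hd]
  have e0 : θ' + (0 : ℝ) • d = θ' := by simp
  rw [e1, e0, Real.norm_eq_abs] at this
  simp only [hd, Pi.sub_apply] at this
  convert this using 2
  ring

end Weights

/-! ### Estimating function and sandwich matrices through the cluster weights -/

section Sample

variable {n m p : ℕ}

lemma prob_eq (X : Matrix (Fin m) (Fin p) ℝ) (β : EuclideanSpace ℝ (Fin p)) (j : Fin m) :
    prob X β j = Real.exp ((X *ᵥ β.ofLp) j) / (1 + Real.exp ((X *ᵥ β.ofLp) j)) := rfl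

lemma sqrt_margVar (X : Matrix (Fin m) (Fin p) ℝ) (β : EuclideanSpace ℝ (Fin p)) (j : Fin m) :
    Real.sqrt (margVar X β j) = sd ((X *ᵥ β.ofLp) j) := by
  rw [margVar, prob_eq, logistic_mul_one_sub, Real.sqrt_sq (sd_pos _).le]

lemma resid_apply (X : Matrix (Fin m) (Fin p) ℝ) (Y : Fin m → ℝ) (β : EuclideanSpace ℝ (Fin p))
    (j : Fin m) : resid X Y β j = res ((X *ᵥ β.ofLp) j) (Y j) := by
  rw [resid, invSqrtA, Matrix.mulVec_diagonal, sqrt_margVar, Pi.sub_apply, prob_eq, inv_sd_mul_sub]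

lemma estFun_eq (R : Matrix (Fin m) (Fin m) ℝ) (X : Fin n → Matrix (Fin m) (Fin p) ℝ)
    (Y : Fin n → Fin m → ℝ) (β : EuclideanSpace ℝ (Fin p)) :
    estFun R X Y β = ∑ i, (X i)ᵀ *ᵥ score (X i *ᵥ β.ofLp) R⁻¹ (Y i) := by
  refine Finset.sum_congr rfl fun i _ => ?_
  rw [Matrix.mul_assoc, Matrix.mul_assoc, ← Matrix.mulVec_mulVec]
  congr 1
  ext j
  have h : invSqrtA (X i) β *ᵥ (Y i - prob (X i) β) = fun k => res ((X i *ᵥ β.ofLp) k) (Y i k) :=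
    funext fun k => resid_apply (X i) (Y i) β k
  rw [← Matrix.mulVec_mulVec, sqrtA, Matrix.mulVec_diagonal, ← Matrix.mulVec_mulVec, sqrt_margVar,
    h]
  rfl

lemma matH_eq (R : Matrix (Fin m) (Fin m) ℝ) (X : Fin n → Matrix (Fin m) (Fin p) ℝ)
    (β : EuclideanSpace ℝ (Fin p)) :
    matH R X β = ∑ i, (X i)ᵀ * Matrix.of (weightH (X i *ᵥ β.ofLp) R⁻¹) * X i := by
  refine Finset.sum_congr rfl fun i _ => ?_
  congr 1
  rw [Matrix.mul_assoc, Matrix.mul_assoc]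
  congr 1
  ext j k
  simp [sqrtA, weightH, sqrt_margVar, Matrix.mul_diagonal, Matrix.diagonal_mul, mul_assoc]

lemma matM_eq (R : Matrix (Fin m) (Fin m) ℝ) (T : Fin n → Matrix (Fin m) (Fin m) ℝ)
    (X : Fin n → Matrix (Fin m) (Fin p) ℝ) (β : EuclideanSpace ℝ (Fin p)) :
    matM R T X β = ∑ i, (X i)ᵀ * Matrix.of (weightM (X i *ᵥ β.ofLp) R⁻¹ (T i)) * X i := by
  refine Finset.sum_congr rfl fun i _ => ?_
  congr 1
  simp only [Matrix.mul_assoc]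
  congr 1
  ext j k
  simp only [sqrtA, weightM, sqrt_margVar, Matrix.mul_diagonal, Matrix.diagonal_mul,
    ← Matrix.mul_assoc, Matrix.of_apply]
  simp only [Matrix.mul_apply, Finset.mul_sum, Finset.sum_mul]
  exact Finset.sum_congr rfl fun _ _ => Finset.sum_congr rfl fun _ _ => by ring_nf

lemma vecMulVec_resid (X : Matrix (Fin m) (Fin p) ℝ) (Y : Fin m → ℝ)
    (β : EuclideanSpace ℝ (Fin p)) :
    Matrix.vecMulVec (resid X Y β) (resid X Y β) = resOuter (X *ᵥ β.ofLp) Y := by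
  ext j k
  rw [Matrix.vecMulVec_apply, resid_apply, resid_apply, resOuter, Matrix.of_apply]

end Sample

section LinearAlgebra

open scoped Matrix.Norms.L2Operator

/-! ### Operator norms and quadratic forms of real matrices -/

lemma dotProduct_self_eq_norm_sq {q : ℕ} (v : EuclideanSpace ℝ (Fin q)) :
    v.ofLp ⬝ᵥ v.ofLp = ‖v‖ ^ 2 := by
  rw [EuclideanSpace.real_norm_sq_eq]
  exact Finset.sum_congr rfl fun _ _ => (sq _).symm

lemma norm_mulVec_le {q r : ℕ} (Z : Matrix (Fin q) (Fin r) ℝ) (v : EuclideanSpace ℝ (Fin r)) :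
    ‖WithLp.toLp 2 (Z *ᵥ v.ofLp)‖ ≤ ‖Z‖ * ‖v‖ :=
  Matrix.l2_opNorm_mulVec Z v

lemma opNorm_le_of_mulVec {q r : ℕ} {Z : Matrix (Fin q) (Fin r) ℝ} {c : ℝ} (hc : 0 ≤ c)
    (h : ∀ v : EuclideanSpace ℝ (Fin r), ‖WithLp.toLp 2 (Z *ᵥ v.ofLp)‖ ≤ c * ‖v‖) : ‖Z‖ ≤ c := by
  rw [Matrix.l2_opNorm_def]
  exact ContinuousLinearMap.opNorm_le_bound _ hc h

lemma dotProduct_le_norm_mul_norm {q : ℕ} (u v : EuclideanSpace ℝ (Fin q)) :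
    |u.ofLp ⬝ᵥ v.ofLp| ≤ ‖u‖ * ‖v‖ := by
  have := abs_real_inner_le_norm v u
  rw [EuclideanSpace.inner_eq_star_dotProduct, star_trivial] at this
  rwa [mul_comm] at this

lemma abs_bilin_le {q r : ℕ} (Z : Matrix (Fin q) (Fin r) ℝ) (u : EuclideanSpace ℝ (Fin q))
    (v : EuclideanSpace ℝ (Fin r)) : |u.ofLp ⬝ᵥ Z *ᵥ v.ofLp| ≤ ‖Z‖ * ‖u‖ * ‖v‖ := by
  refine (dotProduct_le_norm_mul_norm u (WithLp.toLp 2 (Z *ᵥ v.ofLp))).trans ?_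
  calc _ ≤ ‖u‖ * (‖Z‖ * ‖v‖) := by gcongr; exact norm_mulVec_le Z v
    _ = _ := by ring

lemma abs_entry_le_opNorm {q r : ℕ} (Z : Matrix (Fin q) (Fin r) ℝ) (j : Fin q) (k : Fin r) :
    |Z j k| ≤ ‖Z‖ := by
  have := abs_bilin_le Z (EuclideanSpace.single j 1) (EuclideanSpace.single k 1)
  simpa using this

/-- The operator norm is at most the Frobenius norm. -/
lemma opNorm_sq_le {q r : ℕ} (Z : Matrix (Fin q) (Fin r) ℝ) :
    ‖Z‖ ^ 2 ≤ ∑ a : Fin q × Fin r, Z a.1 a.2 ^ 2 := by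
  have h0 : 0 ≤ ∑ a : Fin q × Fin r, Z a.1 a.2 ^ 2 := Finset.sum_nonneg fun _ _ => sq_nonneg _
  rw [← Real.le_sqrt (norm_nonneg _) h0]
  refine opNorm_le_of_mulVec (Real.sqrt_nonneg _) fun v => ?_
  refine abs_le_of_sq_le_sq' ?_ (by positivity) |>.2
  rw [mul_pow, Real.sq_sqrt h0, EuclideanSpace.real_norm_sq_eq, EuclideanSpace.real_norm_sq_eq,
    Fintype.sum_prod_type, Finset.sum_mul]
  exact Finset.sum_le_sum fun a _ =>
    Finset.sum_mul_sq_le_sq_mul_sq Finset.univ (fun b => Z a b) (fun b => v.ofLp b)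

/-- A coercive matrix is invertible, and the inverse has operator norm at most the reciprocal of
the coercivity constant. -/
lemma isUnit_det_and_norm_inv_le {q : ℕ} {Z : Matrix (Fin q) (Fin q) ℝ} {κ : ℝ} (hκ : 0 < κ)
    (h : ∀ v : EuclideanSpace ℝ (Fin q), κ * ‖v‖ ^ 2 ≤ v.ofLp ⬝ᵥ Z *ᵥ v.ofLp) :
    IsUnit Z.det ∧ ‖Z⁻¹‖ ≤ κ⁻¹ := by
  have hu : IsUnit Z.det := by
    rw [isUnit_iff_ne_zero]
    intro h0
    obtain ⟨v, hv, hZ⟩ := Matrix.exists_mulVec_eq_zero_iff.2 h0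
    have := h (WithLp.toLp 2 v)
    rw [hZ, dotProduct_zero, ← dotProduct_self_eq_norm_sq] at this
    have h1 : 0 < v ⬝ᵥ v := by
      refine lt_of_le_of_ne (Finset.sum_nonneg fun i _ => mul_self_nonneg _) fun h => hv ?_
      exact dotProduct_self_eq_zero.1 h.symm
    exact absurd this (not_le.2 (mul_pos hκ h1))
  refine ⟨hu, opNorm_le_of_mulVec (by positivity) fun v => ?_⟩
  set w : EuclideanSpace ℝ (Fin q) := WithLp.toLp 2 (Z⁻¹ *ᵥ v.ofLp) with hw
  have h1 := h w
  have h2 : Z *ᵥ w.ofLp = v.ofLp := by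
    simp [hw, Matrix.mulVec_mulVec, Matrix.mul_nonsing_inv Z hu]
  rw [h2] at h1
  have h3 := h1.trans ((le_abs_self _).trans (dotProduct_le_norm_mul_norm w v))
  rcases (norm_nonneg w).eq_or_lt with h0 | h0
  · rw [← h0]; positivity
  · rw [inv_mul_eq_div, le_div_iff₀ hκ]
    have : ‖w‖ * (‖w‖ * κ) ≤ ‖w‖ * ‖v‖ := by linarith
    exact le_of_mul_le_mul_left this h0

/-- Coercivity survives small perturbations. -/
lemma coercive_of_norm_sub_le {q : ℕ} {Z Z' : Matrix (Fin q) (Fin q) ℝ} {κ : ℝ}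
    (h : ∀ v : EuclideanSpace ℝ (Fin q), κ * ‖v‖ ^ 2 ≤ v.ofLp ⬝ᵥ Z *ᵥ v.ofLp)
    (hZ : ‖Z' - Z‖ ≤ κ / 2) (v : EuclideanSpace ℝ (Fin q)) :
    κ / 2 * ‖v‖ ^ 2 ≤ v.ofLp ⬝ᵥ Z' *ᵥ v.ofLp := by
  have h1 := h v
  have h2 := (abs_le.1 (abs_bilin_le (Z' - Z) v v)).1
  rw [Matrix.sub_mulVec, dotProduct_sub] at h2
  have h3 : ‖Z' - Z‖ * ‖v‖ * ‖v‖ ≤ κ / 2 * ‖v‖ ^ 2 := by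
    rw [mul_assoc, ← sq]; gcongr
  linarith

/-- The quadratic form of a symmetric matrix lies between the bounds of its spectrum. -/
lemma quadForm_bounds_of_spectrum {q : ℕ} {Z : Matrix (Fin q) (Fin q) ℝ} (hZ : Z.IsHermitian)
    {b c : ℝ} (h : spectrum ℝ Z ⊆ Set.Icc b c) (v : EuclideanSpace ℝ (Fin q)) :
    b * ‖v‖ ^ 2 ≤ v.ofLp ⬝ᵥ Z *ᵥ v.ofLp ∧ v.ofLp ⬝ᵥ Z *ᵥ v.ofLp ≤ c * ‖v‖ ^ 2 := by
  have h1 : (Z - algebraMap ℝ _ b).PosSemidef := by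
    refine Matrix.posSemidef_iff_isHermitian_and_spectrum_nonneg.2 ⟨hZ.sub ?_, ?_⟩
    · rw [Algebra.algebraMap_eq_smul_one]
      exact Matrix.isHermitian_one.smul (IsSelfAdjoint.all b)
    · intro x hx
      rw [← spectrum.sub_singleton_eq] at hx
      obtain ⟨y, hy, z, rfl, rfl⟩ := hx
      exact sub_nonneg.2 (h hy).1
  have h2 : (algebraMap ℝ _ c - Z).PosSemidef := by
    refine Matrix.posSemidef_iff_isHermitian_and_spectrum_nonneg.2 ⟨Matrix.IsHermitian.sub ?_ hZ, ?_⟩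
    · rw [Algebra.algebraMap_eq_smul_one]
      exact Matrix.isHermitian_one.smul (IsSelfAdjoint.all c)
    · intro x hx
      rw [← spectrum.singleton_sub_eq] at hx
      obtain ⟨z, rfl, y, hy, rfl⟩ := hx
      exact sub_nonneg.2 (h hy).2
  have h1 := h1.dotProduct_mulVec_nonneg v.ofLp
  have h2 := h2.dotProduct_mulVec_nonneg v.ofLp
  simp only [star_trivial, Matrix.sub_mulVec, dotProduct_sub, Algebra.algebraMap_eq_smul_one,
    Matrix.smul_mulVec, Matrix.one_mulVec, dotProduct_smul, dotProduct_self_eq_norm_sq,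
    smul_eq_mul] at h1 h2
  exact ⟨by linarith, by linarith⟩

/-- The inverse of a positive definite matrix with spectrum in `[c, K]` is bounded by `c⁻¹` and
coercive with constant `K⁻¹`. -/
lemma inv_bounds_of_posDef {q : ℕ} {Z : Matrix (Fin q) (Fin q) ℝ} (hZ : Z.PosDef) {c K : ℝ}
    (hc : 0 < c) (h : spectrum ℝ Z ⊆ Set.Icc c K) :
    ‖Z⁻¹‖ ≤ c⁻¹ ∧ ∀ v : EuclideanSpace ℝ (Fin q),
      K⁻¹ * ‖v‖ ^ 2 ≤ v.ofLp ⬝ᵥ Z⁻¹ *ᵥ v.ofLp := by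
  refine ⟨(isUnit_det_and_norm_inv_le hc fun v =>
    (quadForm_bounds_of_spectrum hZ.isHermitian h v).1).2, fun v => ?_⟩
  refine (quadForm_bounds_of_spectrum hZ.isHermitian.inv (c := c⁻¹) (fun x hx => ?_) v).1
  obtain ⟨u, hu⟩ := hZ.isUnit
  have hx' : x ∈ spectrum ℝ ((u⁻¹ : (Matrix (Fin q) (Fin q) ℝ)ˣ) : Matrix (Fin q) (Fin q) ℝ) := by
    rw [Matrix.coe_units_inv, hu]; exact hx
  have hx0 : x⁻¹ ∈ spectrum ℝ Z := by
    rw [← hu]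
    have := spectrum.inv₀_mem_inv_iff (r := x) (a := u⁻¹)
    rw [inv_inv] at this
    exact this.2 hx'
  have := h hx0
  have hpos : 0 < x⁻¹ := hc.trans_le this.1
  constructor
  · simpa using inv_anti₀ hpos this.2
  · simpa using inv_anti₀ hc this.1

/-- Perturbation of a sandwich `H⁻¹ M H⁻¹`. -/
lemma norm_sandwich_sub_le {q : ℕ} {H H' M M' : Matrix (Fin q) (Fin q) ℝ} {c κ δ N : ℝ}
    (hN : 0 < N) (hc : 0 ≤ c) (hκ : 0 ≤ κ) (hδ : 0 ≤ δ) (hH : IsUnit H.det) (hH' : IsUnit H'.det)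
    (h1 : ‖H⁻¹‖ ≤ c / N) (h2 : ‖H'⁻¹‖ ≤ c / N) (h3 : ‖M‖ ≤ κ * N)
    (h4 : ‖H' - H‖ ≤ δ * N) (h5 : ‖M' - M‖ ≤ δ * N) :
    ‖H'⁻¹ * M' * H'⁻¹ - H⁻¹ * M * H⁻¹‖ ≤ (c ^ 2 + 2 * c ^ 3 * κ) * δ / N := by
  have hd : H'⁻¹ - H⁻¹ = -(H'⁻¹ * (H' - H) * H⁻¹) := by
    rw [mul_sub, sub_mul, Matrix.nonsing_inv_mul _ hH', one_mul, mul_assoc,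
      Matrix.mul_nonsing_inv _ hH, mul_one, neg_sub]
  have hd' : ‖H'⁻¹ - H⁻¹‖ ≤ c / N * (δ * N) * (c / N) := by
    rw [hd, norm_neg]
    refine (norm_mul_le _ _).trans ?_
    have := norm_mul_le H'⁻¹ (H' - H)
    gcongr
    exact this.trans (by gcongr)
  have he : H'⁻¹ * M' * H'⁻¹ - H⁻¹ * M * H⁻¹
      = H'⁻¹ * (M' - M) * H'⁻¹ + ((H'⁻¹ - H⁻¹) * M * H'⁻¹ + H⁻¹ * M * (H'⁻¹ - H⁻¹)) := by
    noncomm_ring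
  have b1 : ‖H'⁻¹ * (M' - M) * H'⁻¹‖ ≤ c / N * (δ * N) * (c / N) := by
    refine (norm_mul_le _ _).trans ?_
    have := norm_mul_le H'⁻¹ (M' - M)
    gcongr
    exact this.trans (by gcongr)
  have b2 : ‖(H'⁻¹ - H⁻¹) * M * H'⁻¹‖ ≤ c / N * (δ * N) * (c / N) * (κ * N) * (c / N) := by
    refine (norm_mul_le _ _).trans ?_
    have := norm_mul_le (H'⁻¹ - H⁻¹) M
    gcongr
    exact this.trans (by gcongr)
  have b3 : ‖H⁻¹ * M * (H'⁻¹ - H⁻¹)‖ ≤ c / N * (κ * N) * (c / N * (δ * N) * (c / N)) := by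
    refine (norm_mul_le _ _).trans ?_
    have := norm_mul_le H⁻¹ M
    gcongr
    exact this.trans (by gcongr)
  rw [he]
  refine (norm_add_le _ _).trans ((add_le_add b1 ((norm_add_le _ _).trans (add_le_add b2 b3))).trans
    (le_of_eq ?_))
  field_simp
  ring

lemma frobNorm_sq {k l : ℕ} (B : Matrix (Fin k) (Fin l) ℝ) :
    frobNorm B ^ 2 = ∑ i, ∑ j, B i j ^ 2 := by
  have h : (B * Bᵀ).trace = ∑ i, ∑ j, B i j ^ 2 := by
    simp [Matrix.trace, Matrix.mul_apply, sq]
  rw [frobNorm, h, Real.sq_sqrt]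
  exact Finset.sum_nonneg fun _ _ => Finset.sum_nonneg fun _ _ => sq_nonneg _

lemma frobNorm_nonneg {k l : ℕ} (B : Matrix (Fin k) (Fin l) ℝ) : 0 ≤ frobNorm B :=
  Real.sqrt_nonneg _

lemma abs_entry_le_frobNorm {k l : ℕ} (B : Matrix (Fin k) (Fin l) ℝ) (i : Fin k) (j : Fin l) :
    |B i j| ≤ frobNorm B := by
  refine abs_le_of_sq_le_sq ?_ (frobNorm_nonneg B)
  rw [frobNorm_sq]
  exact (Finset.single_le_sum (f := fun j => B i j ^ 2) (fun _ _ => sq_nonneg _)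
    (Finset.mem_univ j)).trans (Finset.single_le_sum (f := fun i => ∑ j, B i j ^ 2)
      (fun _ _ => Finset.sum_nonneg fun _ _ => sq_nonneg _) (Finset.mem_univ i))

/-- Conjugation by a matrix `C` with few rows turns operator norm control into Frobenius norm
control, whatever the number of columns. -/
lemma frobNorm_conj_le {l q : ℕ} (C : Matrix (Fin l) (Fin q) ℝ) (D : Matrix (Fin q) (Fin q) ℝ) :
    frobNorm (C * D * Cᵀ) ≤ ‖D‖ * (C * Cᵀ).trace := by
  set c : Fin l → EuclideanSpace ℝ (Fin q) := fun a => WithLp.toLp 2 (C a) with hc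
  have ht : (C * Cᵀ).trace = ∑ a, ‖c a‖ ^ 2 :=
    Finset.sum_congr rfl fun a _ => dotProduct_self_eq_norm_sq (c a)
  have h0 : 0 ≤ ∑ a, ‖c a‖ ^ 2 := Finset.sum_nonneg fun _ _ => sq_nonneg _
  have he : ∀ a b, |(C * D * Cᵀ) a b| ≤ ‖D‖ * ‖c a‖ * ‖c b‖ := by
    intro a b
    have : (C * D * Cᵀ) a b = (c a).ofLp ⬝ᵥ D *ᵥ (c b).ofLp := by
      rw [Matrix.dotProduct_mulVec]; rfl
    rw [this]
    exact abs_bilin_le _ _ _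
  rw [ht]
  refine abs_le_of_sq_le_sq' ?_ (by positivity) |>.2
  calc frobNorm (C * D * Cᵀ) ^ 2 = ∑ a, ∑ b, (C * D * Cᵀ) a b ^ 2 := frobNorm_sq _
    _ ≤ ∑ a, ∑ b, (‖D‖ * ‖c a‖ * ‖c b‖) ^ 2 := by
      refine Finset.sum_le_sum fun a _ => Finset.sum_le_sum fun b _ => ?_
      exact sq_le_sq' (abs_le.1 (he a b)).1 (abs_le.1 (he a b)).2
    _ = _ := by
      rw [mul_pow, sq (∑ a, ‖c a‖ ^ 2), Finset.sum_mul_sum, Finset.mul_sum]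
      refine Finset.sum_congr rfl fun a _ => ?_
      rw [Finset.mul_sum]
      exact Finset.sum_congr rfl fun b _ => by ring

/-! ### Sums over clusters under bounds on the design -/

section Design

variable {n m p : ℕ} (X : Fin n → Matrix (Fin m) (Fin p) ℝ)

lemma dotProduct_gram (v : Fin p → ℝ) :
    v ⬝ᵥ (∑ i, (X i)ᵀ * X i) *ᵥ v = ∑ i, ∑ j, (X i *ᵥ v) j ^ 2 := by
  rw [Matrix.sum_mulVec, dotProduct_sum]
  refine Finset.sum_congr rfl fun i _ => ?_
  rw [← Matrix.mulVec_mulVec, Matrix.dotProduct_mulVec, Matrix.vecMul_transpose]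
  exact Finset.sum_congr rfl fun j _ => (sq _).symm

/-- Eigenvalue bounds on the normalized design matrix, as bounds on sums of squares. -/
lemma gram_bounds {b₃ b₄ : ℝ} (hn : 0 < n)
    (h : spectrum ℝ ((n : ℝ)⁻¹ • ∑ i, (X i)ᵀ * X i) ⊆ Set.Icc b₃ b₄)
    (v : EuclideanSpace ℝ (Fin p)) :
    b₃ * n * ‖v‖ ^ 2 ≤ ∑ i, ∑ j, (X i *ᵥ v.ofLp) j ^ 2 ∧
      ∑ i, ∑ j, (X i *ᵥ v.ofLp) j ^ 2 ≤ b₄ * n * ‖v‖ ^ 2 := by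
  have hH : ((n : ℝ)⁻¹ • ∑ i, (X i)ᵀ * X i).IsHermitian := by
    rw [Matrix.IsHermitian, Matrix.conjTranspose_eq_transpose_of_trivial, Matrix.transpose_smul,
      Matrix.transpose_sum]
    simp
  have hn' : (0 : ℝ) < n := by exact_mod_cast hn
  obtain ⟨h1, h2⟩ := quadForm_bounds_of_spectrum hH h v
  rw [Matrix.smul_mulVec, dotProduct_smul, dotProduct_gram, smul_eq_mul] at h1 h2
  rw [← div_eq_inv_mul] at h1 h2
  rw [le_div_iff₀ hn'] at h1
  rw [div_le_iff₀ hn'] at h2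
  exact ⟨by linarith, by linarith⟩

variable {X}

/-- Cluster vectors dominated by the linear predictors of a direction `d` contribute at most the
maximal eigenvalue of the design times `‖d‖`. -/
lemma norm_sum_transpose_mulVec_le {Λ δ : ℝ} (hΛ0 : 0 ≤ Λ) (hδ : 0 ≤ δ)
    (hΛ : ∀ v : EuclideanSpace ℝ (Fin p), ∑ i, ∑ j, (X i *ᵥ v.ofLp) j ^ 2 ≤ Λ * ‖v‖ ^ 2)
    (u : Fin n → Fin m → ℝ) (d : EuclideanSpace ℝ (Fin p))
    (hu : ∀ i j, |u i j| ≤ δ * ∑ k, |(X i *ᵥ d.ofLp) k|) :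
    ‖WithLp.toLp 2 (∑ i, (X i)ᵀ *ᵥ u i)‖ ≤ δ * m * Λ * ‖d‖ := by
  set w : EuclideanSpace ℝ (Fin p) := WithLp.toLp 2 (∑ i, (X i)ᵀ *ᵥ u i) with hw
  have h1 : ‖w‖ ^ 2 = ∑ i, ∑ j, (X i *ᵥ w.ofLp) j * u i j := by
    rw [← dotProduct_self_eq_norm_sq]
    have : w.ofLp ⬝ᵥ w.ofLp = w.ofLp ⬝ᵥ ∑ i, (X i)ᵀ *ᵥ u i := rfl
    rw [this, dotProduct_sum]
    refine Finset.sum_congr rfl fun i _ => ?_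
    rw [Matrix.dotProduct_mulVec, Matrix.vecMul_transpose]
    rfl
  set Q := ∑ q : Fin n × Fin m × Fin m,
    |(X q.1 *ᵥ w.ofLp) q.2.1| * |(X q.1 *ᵥ d.ofLp) q.2.2| with hQ
  have h2 : ‖w‖ ^ 2 ≤ δ * Q := by
    rw [h1, hQ, Fintype.sum_prod_type, Finset.mul_sum]
    refine Finset.sum_le_sum fun i _ => ?_
    rw [Fintype.sum_prod_type, Finset.mul_sum]
    refine Finset.sum_le_sum fun j _ => ?_
    refine (le_abs_self _).trans ?_
    simp only [abs_mul, ← Finset.mul_sum]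
    calc _ ≤ |(X i *ᵥ w.ofLp) j| * (δ * ∑ k, |(X i *ᵥ d.ofLp) k|) := by gcongr; exact hu i j
      _ = _ := by ring
  have h3 : Q ^ 2 ≤ (m * Λ * ‖w‖ * ‖d‖) ^ 2 := by
    refine (Finset.sum_mul_sq_le_sq_mul_sq _ _ _).trans ?_
    have e1 : ∑ q : Fin n × Fin m × Fin m, |(X q.1 *ᵥ w.ofLp) q.2.1| ^ 2
        = m * ∑ i, ∑ j, (X i *ᵥ w.ofLp) j ^ 2 := by
      simp [Fintype.sum_prod_type, Finset.mul_sum]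
    have e2 : ∑ q : Fin n × Fin m × Fin m, |(X q.1 *ᵥ d.ofLp) q.2.2| ^ 2
        = m * ∑ i, ∑ j, (X i *ᵥ d.ofLp) j ^ 2 := by
      simp [Fintype.sum_prod_type, Finset.mul_sum]
    rw [e1, e2]
    calc _ ≤ (m * (Λ * ‖w‖ ^ 2)) * (m * (Λ * ‖d‖ ^ 2)) := by
          gcongr
          · exact hΛ w
          · exact hΛ d
      _ = _ := by ring
  have h4 : Q ≤ m * Λ * ‖w‖ * ‖d‖ := (abs_le_of_sq_le_sq' h3 (by positivity)).2
  rcases (norm_nonneg w).eq_or_lt with h0 | h0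
  · rw [← h0]; positivity
  · refine le_of_mul_le_mul_left ?_ h0
    calc ‖w‖ * ‖w‖ = ‖w‖ ^ 2 := (sq _).symm
      _ ≤ δ * Q := h2
      _ ≤ δ * (m * Λ * ‖w‖ * ‖d‖) := by gcongr
      _ = _ := by ring

/-- Uniformly small cluster weights give a small weighted design matrix. -/
lemma norm_sum_weighted_le {Λ δ : ℝ} (hΛ0 : 0 ≤ Λ) (hδ : 0 ≤ δ)
    (hΛ : ∀ v : EuclideanSpace ℝ (Fin p), ∑ i, ∑ j, (X i *ᵥ v.ofLp) j ^ 2 ≤ Λ * ‖v‖ ^ 2)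
    (V : Fin n → Matrix (Fin m) (Fin m) ℝ) (hV : ∀ i j k, |V i j k| ≤ δ) :
    ‖∑ i, (X i)ᵀ * V i * X i‖ ≤ δ * m * Λ := by
  refine opNorm_le_of_mulVec (by positivity) fun d => ?_
  rw [Matrix.sum_mulVec]
  simp only [Matrix.mul_assoc, ← Matrix.mulVec_mulVec]
  refine norm_sum_transpose_mulVec_le hΛ0 hδ hΛ _ d fun i j => ?_
  rw [Finset.mul_sum]
  refine (Finset.abs_sum_le_sum_abs (fun k => V i j k * (X i *ᵥ d.ofLp) k) Finset.univ).trans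
    (Finset.sum_le_sum fun k _ => ?_)
  rw [abs_mul]
  gcongr
  exact hV i j k

/-- The difference of two weighted design matrices with uniformly close weights. -/
lemma norm_sum_weighted_sub_le {Λ δ : ℝ} (hΛ0 : 0 ≤ Λ) (hδ : 0 ≤ δ)
    (hΛ : ∀ v : EuclideanSpace ℝ (Fin p), ∑ i, ∑ j, (X i *ᵥ v.ofLp) j ^ 2 ≤ Λ * ‖v‖ ^ 2)
    (V V' : Fin n → Matrix (Fin m) (Fin m) ℝ) (hV : ∀ i j k, |V i j k - V' i j k| ≤ δ) :
    ‖∑ i, (X i)ᵀ * V i * X i - ∑ i, (X i)ᵀ * V' i * X i‖ ≤ δ * m * Λ := by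
  rw [← Finset.sum_sub_distrib]
  simp only [← Matrix.sub_mul, ← Matrix.mul_sub]
  exact norm_sum_weighted_le hΛ0 hδ hΛ (fun i => V i - V' i) hV

/-- `H` is coercive when the design, the inverse working correlation and the marginal standard
deviations are bounded from below. -/
lemma coercive_matH {b κ s : ℝ} (hκ : 0 ≤ κ) (hs : 0 ≤ s)
    (hb : ∀ v : EuclideanSpace ℝ (Fin p), b * ‖v‖ ^ 2 ≤ ∑ i, ∑ j, (X i *ᵥ v.ofLp) j ^ 2)
    (R : Matrix (Fin m) (Fin m) ℝ)
    (hR : ∀ v : EuclideanSpace ℝ (Fin m), κ * ‖v‖ ^ 2 ≤ v.ofLp ⬝ᵥ R⁻¹ *ᵥ v.ofLp)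
    (β : EuclideanSpace ℝ (Fin p)) (hsd : ∀ i j, s ≤ sd ((X i *ᵥ β.ofLp) j))
    (v : EuclideanSpace ℝ (Fin p)) :
    κ * s ^ 2 * b * ‖v‖ ^ 2 ≤ v.ofLp ⬝ᵥ matH R X β *ᵥ v.ofLp := by
  rw [matH, Matrix.sum_mulVec, dotProduct_sum]
  calc κ * s ^ 2 * b * ‖v‖ ^ 2 = κ * s ^ 2 * (b * ‖v‖ ^ 2) := by ring
    _ ≤ κ * s ^ 2 * ∑ i, ∑ j, (X i *ᵥ v.ofLp) j ^ 2 := by gcongr; exact hb v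
    _ ≤ _ := by
      rw [Finset.mul_sum]
      refine Finset.sum_le_sum fun i _ => ?_
      set x : EuclideanSpace ℝ (Fin m) := WithLp.toLp 2 (sqrtA (X i) β *ᵥ X i *ᵥ v.ofLp) with hx
      have e : v.ofLp ⬝ᵥ ((X i)ᵀ * sqrtA (X i) β * R⁻¹ * sqrtA (X i) β * X i) *ᵥ v.ofLp
          = x.ofLp ⬝ᵥ R⁻¹ *ᵥ x.ofLp := by
        rw [hx]
        simp only [← Matrix.mulVec_mulVec, Matrix.mul_assoc]
        rw [Matrix.dotProduct_mulVec, Matrix.vecMul_transpose, Matrix.dotProduct_mulVec]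
        congr 1
        rw [sqrtA]
        ext j
        rw [Matrix.vecMul_diagonal, Matrix.mulVec_diagonal, mul_comm]
      rw [e]
      refine le_trans ?_ (hR x)
      rw [mul_assoc]
      gcongr
      rw [EuclideanSpace.real_norm_sq_eq, Finset.mul_sum]
      refine Finset.sum_le_sum fun j _ => ?_
      have : x.ofLp j = sd ((X i *ᵥ β.ofLp) j) * (X i *ᵥ v.ofLp) j := by
        rw [hx]; simp only [sqrtA]
        rw [Matrix.mulVec_diagonal, sqrt_margVar]
      rw [this, mul_pow]
      gcongr
      exact hsd i j

end Design

end LinearAlgebra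

/-! ### Events of probability tending to one -/

section Stochastic

variable {Ω : ℕ → Type*} [∀ n, MeasurableSpace (Ω n)] {P : ∀ n, Measure (Ω n)}

/-- The events `E n` have probability tending to one. This is phrased through the complements, so
that no measurability of `E n` is needed. -/
def HighProb (P : ∀ n, Measure (Ω n)) (E : ∀ n, Set (Ω n)) : Prop :=
  Tendsto (fun n => P n (E n)ᶜ) atTop (𝓝 0)

lemma HighProb.mono {E E' : ∀ n, Set (Ω n)} (h : HighProb P E)
    (hE : ∀ᶠ n in atTop, E n ⊆ E' n) : HighProb P E' :=
  tendsto_of_tendsto_of_tendsto_of_le_of_le' tendsto_const_nhds h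
    (Eventually.of_forall fun _ => zero_le)
    (hE.mono fun _ hn => measure_mono (Set.compl_subset_compl.2 hn))

lemma HighProb.inter {E E' : ∀ n, Set (Ω n)} (h : HighProb P E) (h' : HighProb P E') :
    HighProb P fun n => E n ∩ E' n := by
  have := Tendsto.add h h'
  rw [add_zero] at this
  refine tendsto_of_tendsto_of_tendsto_of_le_of_le tendsto_const_nhds this
    (fun _ => zero_le) fun n => ?_
  rw [Set.compl_inter]
  exact measure_union_le _ _

lemma HighProb.iInter {ι : Type*} [Fintype ι] {E : ι → ∀ n, Set (Ω n)}
    (h : ∀ a, HighProb P (E a)) : HighProb P fun n => ⋂ a, E a n := by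
  have := tendsto_finsetSum Finset.univ fun a _ => h a
  rw [Finset.sum_const_zero] at this
  refine tendsto_of_tendsto_of_tendsto_of_le_of_le tendsto_const_nhds this
    (fun _ => zero_le) fun n => ?_
  rw [Set.compl_iInter]
  exact measure_iUnion_fintype_le _ _

lemma HighProb.tendsto_one [∀ n, IsProbabilityMeasure (P n)] {E : ∀ n, Set (Ω n)}
    (h : HighProb P E) : Tendsto (fun n => P n (E n)) atTop (𝓝 1) := by
  have h1 : Tendsto (fun n => 1 - P n (E n)ᶜ) atTop (𝓝 (1 - 0)) :=
    ENNReal.Tendsto.sub tendsto_const_nhds h (Or.inl ENNReal.one_ne_top)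
  rw [tsub_zero] at h1
  refine tendsto_of_tendsto_of_tendsto_of_le_of_le h1 tendsto_const_nhds (fun n => ?_)
    fun n => prob_le_one
  rw [tsub_le_iff_right, ← measure_univ (μ := P n), ← Set.union_compl_self (E n)]
  exact measure_union_le _ _

lemma IsBigOp.highProb {Z : ∀ n, Ω n → ℝ} {r t : ℕ → ℝ} (h : IsBigOp P Z r)
    (ht : ∀ K : ℝ, ∀ᶠ n in atTop, K * r n ≤ t n) :
    HighProb P fun n => {ω | |Z n ω| ≤ t n} := by
  refine ENNReal.tendsto_nhds_zero.2 fun ε hε => ?_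
  obtain ⟨ε', hε', hle⟩ : ∃ ε' : ℝ, 0 < ε' ∧ ENNReal.ofReal ε' ≤ ε := by
    rcases eq_or_ne ε ⊤ with rfl | htop
    · exact ⟨1, one_pos, le_top⟩
    · exact ⟨ε.toReal, ENNReal.toReal_pos hε.ne' htop, ENNReal.ofReal_toReal_le⟩
  obtain ⟨K, -, hK⟩ := h ε' hε'
  filter_upwards [hK, ht K] with n h1 h2
  refine (measure_mono fun ω hω => ?_).trans (h1.trans hle)
  exact h2.trans_lt (not_le.1 hω)

lemma IsBigOp.of_abs_le {Z Z' : ∀ n, Ω n → ℝ} {r : ℕ → ℝ} {E : ∀ n, Set (Ω n)} {c : ℝ}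
    (h : IsBigOp P Z r) (hE : HighProb P E) (hc : 0 < c)
    (hZ : ∀ᶠ n in atTop, ∀ ω ∈ E n, |Z' n ω| ≤ c * |Z n ω|) : IsBigOp P Z' r := by
  intro ε hε
  obtain ⟨K, hK0, hK⟩ := h (ε / 2) (half_pos hε)
  have hE' := (ENNReal.tendsto_nhds_zero.1 hE) (ENNReal.ofReal (ε / 2)) (by simpa using hε)
  refine ⟨c * K, by positivity, ?_⟩
  filter_upwards [hK, hE', hZ] with n h1 h2 h3
  calc P n {ω | c * K * r n < |Z' n ω|} ≤ P n ((E n)ᶜ ∪ {ω | K * r n < |Z n ω|}) := by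
        refine measure_mono fun ω hω => ?_
        by_cases hωE : ω ∈ E n
        · right
          have h4 : c * (K * r n) < c * |Z n ω| := by
            rw [← mul_assoc]
            exact lt_of_lt_of_le hω (h3 ω hωE)
          exact lt_of_mul_lt_mul_left h4 hc.le
        · exact Or.inl hωE
    _ ≤ _ := measure_union_le _ _
    _ ≤ ENNReal.ofReal (ε / 2) + ENNReal.ofReal (ε / 2) := add_le_add h2 h1
    _ = ENNReal.ofReal ε := by
        rw [← ENNReal.ofReal_add (by positivity) (by positivity), add_halves]

lemma IsBigOp.sum {ι : Type*} (s : Finset ι) {Z : ι → ∀ n, Ω n → ℝ} {r : ℕ → ℝ}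
    (hr : ∀ n, 0 ≤ r n) (h : ∀ a ∈ s, IsBigOp P (Z a) r) :
    IsBigOp P (fun n ω => ∑ a ∈ s, Z a n ω) r := by
  classical
  induction s using Finset.induction_on with
  | empty =>
    refine fun ε hε => ⟨1, one_pos, Eventually.of_forall fun n => ?_⟩
    have : {ω : Ω n | 1 * r n < |∑ a ∈ (∅ : Finset ι), Z a n ω|} = ∅ := by
      ext ω; simpa using hr n
    rw [this]; simp
  | insert a s ha ih =>
    intro ε hε
    obtain ⟨K, hK0, hK⟩ := h a (Finset.mem_insert_self _ _) (ε / 2) (half_pos hε)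
    obtain ⟨K', hK0', hK'⟩ := ih (fun b hb => h b (Finset.mem_insert_of_mem hb)) (ε / 2)
      (half_pos hε)
    refine ⟨K + K', by positivity, ?_⟩
    filter_upwards [hK, hK'] with n h1 h2
    calc _ ≤ P n ({ω | K * r n < |Z a n ω|} ∪ {ω | K' * r n < |∑ a ∈ s, Z a n ω|}) := by
          refine measure_mono fun ω hω => ?_
          rw [Set.mem_ofPred_eq, Finset.sum_insert ha] at hω
          by_contra hcon
          rw [Set.mem_union, not_or] at hcon
          have e1 : |Z a n ω| ≤ K * r n := not_lt.1 fun h => hcon.1 h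
          have e2 : |∑ a ∈ s, Z a n ω| ≤ K' * r n := not_lt.1 fun h => hcon.2 h
          have := abs_add_le (Z a n ω) (∑ a ∈ s, Z a n ω)
          linarith
      _ ≤ _ := measure_union_le _ _
      _ ≤ ENNReal.ofReal (ε / 2) + ENNReal.ofReal (ε / 2) := add_le_add h1 h2
      _ = ENNReal.ofReal ε := by
          rw [← ENNReal.ofReal_add (by positivity) (by positivity), add_halves]

end Stochastic

/-! ### Sums of independent bounded centred variables -/

/-- Independent measurable centred random variables with common bound `C`. -/
structure IsCentered {Ω : Type*} [MeasurableSpace Ω] (μ : Measure Ω) {n : ℕ}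
    (ξ : Fin n → Ω → ℝ) (C : ℝ) : Prop where
  measurable : ∀ i, Measurable (ξ i)
  indep : iIndepFun ξ μ
  mean : ∀ i, ∫ ω, ξ i ω ∂μ = 0
  bound : ∀ i ω, |ξ i ω| ≤ C

section Chebyshev

variable {Ω : Type*} [MeasurableSpace Ω] {μ : Measure Ω} [IsProbabilityMeasure μ] {n : ℕ}
  {ξ : Fin n → Ω → ℝ} {C : ℝ}

lemma IsCentered.memLp (h : IsCentered μ ξ C) (c : Fin n → ℝ) (i : Fin n) :
    MemLp (fun ω => ξ i ω * c i) 2 μ := by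
  refine MemLp.of_bound ((h.measurable i).mul_const _).aestronglyMeasurable (C * |c i|)
    (Eventually.of_forall fun ω => ?_)
  rw [norm_mul, Real.norm_eq_abs, Real.norm_eq_abs]
  exact mul_le_mul_of_nonneg_right (h.bound i ω) (abs_nonneg _)

lemma IsCentered.integral_sq_sum_le (h : IsCentered μ ξ C) (c : Fin n → ℝ) :
    ∫ ω, (∑ i, ξ i ω * c i) ^ 2 ∂μ ≤ C ^ 2 * ∑ i, c i ^ 2 := by
  have hmem := h.memLp c
  have hmean : ∀ i, ∫ ω, ξ i ω * c i ∂μ = 0 := fun i => by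
    rw [integral_mul_const, h.mean, zero_mul]
  have hvar : Var[∑ i, fun ω => ξ i ω * c i; μ] = ∑ i, Var[fun ω => ξ i ω * c i; μ] := by
    refine IndepFun.variance_sum (fun i _ => hmem i) fun i _ j _ hij => ?_
    exact (h.indep.indepFun hij).comp (measurable_id.mul_const (c i))
      (measurable_id.mul_const (c j))
  have hsum : (∑ i, fun ω => ξ i ω * c i) = fun ω => ∑ i, ξ i ω * c i := by
    ext ω; simp
  rw [hsum, variance_of_integral_eq_zero] at hvar
  · rw [hvar, Finset.mul_sum]
    refine Finset.sum_le_sum fun i _ => ?_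
    rw [variance_of_integral_eq_zero (hmem i).aemeasurable (hmean i)]
    calc ∫ ω, (ξ i ω * c i) ^ 2 ∂μ ≤ ∫ _, C ^ 2 * c i ^ 2 ∂μ := by
          refine integral_mono (hmem i).integrable_sq (integrable_const _) fun ω => ?_
          simp only [mul_pow]
          exact mul_le_mul_of_nonneg_right
            (sq_le_sq' (abs_le.1 (h.bound i ω)).1 (abs_le.1 (h.bound i ω)).2) (sq_nonneg _)
      _ = _ := by simp
  · exact (memLp_finsetSum _ fun i _ => hmem i).aemeasurable
  · rw [integral_finsetSum _ fun i _ => (hmem i).integrable (by norm_num)]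
    simp [hmean]

/-- Chebyshev's inequality for a sum of independent centred multiples of fixed vectors. -/
lemma IsCentered.measure_sum_sq_le (h : IsCentered μ ξ C) {ι : Type*} [Fintype ι]
    (e : Fin n → ι → ℝ) {L t : ℝ} (he : ∀ i, ∑ a, e i a ^ 2 ≤ L) (ht : 0 < t) :
    μ {ω | t < ∑ a, (∑ i, ξ i ω * e i a) ^ 2} ≤ ENNReal.ofReal (n * C ^ 2 * L / t) := by
  have hint : ∀ a, Integrable (fun ω => (∑ i, ξ i ω * e i a) ^ 2) μ := fun a =>
    (memLp_finsetSum _ fun i _ => h.memLp (fun i => e i a) i).integrable_sq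
  have hint' := integrable_finsetSum Finset.univ fun a _ => hint a
  have h1 : ∫ ω, ∑ a, (∑ i, ξ i ω * e i a) ^ 2 ∂μ ≤ n * C ^ 2 * L := by
    rw [integral_finsetSum _ fun a _ => hint a]
    calc _ ≤ ∑ a, C ^ 2 * ∑ i, e i a ^ 2 :=
          Finset.sum_le_sum fun a _ => h.integral_sq_sum_le fun i => e i a
      _ = C ^ 2 * ∑ i, ∑ a, e i a ^ 2 := by rw [← Finset.mul_sum, Finset.sum_comm]
      _ ≤ C ^ 2 * ∑ _i : Fin n, L := by gcongr with i; exact he i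
      _ = _ := by simp; ring
  have h2 := mul_meas_ge_le_integral_of_nonneg (μ := μ)
    (Eventually.of_forall fun ω => Finset.sum_nonneg fun a _ =>
      sq_nonneg (∑ i, ξ i ω * e i a)) hint' t
  have h3 : μ.real {ω | t < ∑ a, (∑ i, ξ i ω * e i a) ^ 2} ≤ n * C ^ 2 * L / t := by
    rw [le_div_iff₀ ht, mul_comm]
    refine le_trans ?_ (h2.trans h1)
    refine mul_le_mul_of_nonneg_left (measureReal_mono fun ω hω => ?_) ht.le
    rw [Set.mem_ofPred_eq] at hω ⊢
    exact hω.le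
  rw [← ofReal_measureReal]
  exact ENNReal.ofReal_le_ofReal h3

end Chebyshev

section Limits

open scoped Matrix.Norms.L2Operator

variable {Ω : ℕ → Type*} [∀ n, MeasurableSpace (Ω n)] {P : ∀ n, Measure (Ω n)}
  [∀ n, IsProbabilityMeasure (P n)] {m : ℕ} {p : ℕ → ℕ}
  {X : ∀ n, Fin n → Matrix (Fin m) (Fin (p n)) ℝ}

/-- A weighted design matrix with independent centred bounded weights is of smaller order than
`n`. -/
lemma highProb_norm_sum_weighted {C K : ℝ}
    (hX : ∀ᶠ n in atTop, ∀ i j, ∑ a, X n i j a ^ 2 ≤ K * p n)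
    (V : ∀ n, Fin n → Ω n → Matrix (Fin m) (Fin m) ℝ)
    (hV : ∀ᶠ n in atTop, ∀ j k, IsCentered (P n) (fun i ω => V n i ω j k) C)
    (hdim : Tendsto (fun n => (p n : ℝ) ^ 2 / n) atTop (𝓝 0)) {δ : ℝ} (hδ : 0 < δ) :
    HighProb P fun n => {ω | ‖∑ i, (X n i)ᵀ * V n i ω * X n i‖ ≤ δ * n} := by
  -- each of the `m * m` pairs of rows contributes one sum of rank-one matrices; the `+ 1` only
  -- keeps the denominator positive
  set δ' := δ / (m * m + 1) with hδ'
  have hδ'0 : 0 < δ' := by positivity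
  have key : ∀ q : Fin m × Fin m, HighProb P fun n => {ω |
      ∑ a : Fin (p n) × Fin (p n),
        (∑ i, V n i ω q.1 q.2 * (X n i q.1 a.1 * X n i q.2 a.2)) ^ 2 ≤ (δ' * n) ^ 2} := by
    intro q
    have hlim : Tendsto (fun n : ℕ => ENNReal.ofReal (C ^ 2 * K ^ 2 / δ' ^ 2 * ((p n : ℝ) ^ 2 / n)))
        atTop (𝓝 0) := by
      have := ENNReal.tendsto_ofReal (hdim.const_mul (C ^ 2 * K ^ 2 / δ' ^ 2))
      simpa using this
    refine tendsto_of_tendsto_of_tendsto_of_le_of_le' tendsto_const_nhds hlim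
      (Eventually.of_forall fun _ => zero_le) ?_
    filter_upwards [hX, hV, eventually_gt_atTop 0] with n h1 h2 hn
    have hn' : (0 : ℝ) < n := by exact_mod_cast hn
    have h3 := (h2 q.1 q.2).measure_sum_sq_le
      (fun i (a : Fin (p n) × Fin (p n)) => X n i q.1 a.1 * X n i q.2 a.2)
      (L := (K * p n) * (K * p n)) (t := (δ' * n) ^ 2) (fun i => ?_) (by positivity)
    · refine (measure_mono fun ω hω => ?_).trans (h3.trans (le_of_eq ?_))
      · rw [Set.mem_compl_iff, Set.mem_ofPred_eq, not_le] at hω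
        exact hω
      · congr 1; field_simp
    · have : ∑ a : Fin (p n) × Fin (p n), (X n i q.1 a.1 * X n i q.2 a.2) ^ 2
          = (∑ a, X n i q.1 a ^ 2) * ∑ a, X n i q.2 a ^ 2 := by
        rw [Finset.sum_mul_sum, Fintype.sum_prod_type]
        exact Finset.sum_congr rfl fun a _ => Finset.sum_congr rfl fun b _ => mul_pow _ _ _
      rw [this]
      exact mul_le_mul (h1 i q.1) (h1 i q.2) (Finset.sum_nonneg fun _ _ => sq_nonneg _)
        ((Finset.sum_nonneg fun _ _ => sq_nonneg _).trans (h1 i q.1))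
  refine (HighProb.iInter key).mono (Eventually.of_forall fun n ω hω => ?_)
  rw [Set.mem_iInter] at hω
  set Z : Fin m × Fin m → Matrix (Fin (p n)) (Fin (p n)) ℝ := fun q =>
    Matrix.of fun a b => ∑ i, V n i ω q.1 q.2 * (X n i q.1 a * X n i q.2 b) with hZ
  have hsum : ∑ i, (X n i)ᵀ * V n i ω * X n i = ∑ q, Z q := by
    ext a b
    simp only [Matrix.sum_apply, hZ, Matrix.of_apply, Matrix.mul_apply, Matrix.transpose_apply]
    rw [Finset.sum_comm (s := (Finset.univ : Finset (Fin m × Fin m)))]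
    refine Finset.sum_congr rfl fun i _ => ?_
    rw [Fintype.sum_prod_type, Finset.sum_comm]
    refine Finset.sum_congr rfl fun k _ => ?_
    rw [Finset.sum_mul]
    exact Finset.sum_congr rfl fun j _ => by ring
  have hZq : ∀ q, ‖Z q‖ ≤ δ' * n := fun q =>
    (abs_le_of_sq_le_sq' ((opNorm_sq_le (Z q)).trans (hω q)) (by positivity)).2
  rw [Set.mem_ofPred_eq, hsum]
  calc ‖∑ q, Z q‖ ≤ ∑ q, ‖Z q‖ := norm_sum_le _ _
    _ ≤ ∑ _q : Fin m × Fin m, δ' * n := Finset.sum_le_sum fun q _ => hZq q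
    _ = (m * m) * δ' * n := by simp; ring
    _ ≤ δ * n := by
      gcongr
      rw [hδ', mul_div_assoc', div_le_iff₀ (by positivity)]
      nlinarith

/-- A sum of rows of the design with independent centred bounded weights is `O_p(√(n p))`. -/
lemma isBigOp_norm_sum_rows {C K : ℝ} (hp : ∀ n, 0 < p n)
    (hX : ∀ᶠ n in atTop, ∀ i j, ∑ a, X n i j a ^ 2 ≤ K * p n)
    (j : Fin m) (ξ : ∀ n, Fin n → Ω n → ℝ)
    (hξ : ∀ᶠ n in atTop, IsCentered (P n) (ξ n) C) :
    IsBigOp P (fun n ω => ‖∑ i, ξ n i ω • (WithLp.toLp 2 (X n i j) : EuclideanSpace ℝ (Fin (p n)))‖)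
      (fun n => Real.sqrt (n * p n)) := by
  intro ε hε
  refine ⟨Real.sqrt ((C ^ 2 * |K| + 1) / ε), Real.sqrt_pos.2 (by positivity), ?_⟩
  filter_upwards [hX, hξ, eventually_gt_atTop 0] with n h1 h2 hn
  have hn' : (0 : ℝ) < n := by exact_mod_cast hn
  have hp' : (0 : ℝ) < p n := by exact_mod_cast hp n
  have h3 := h2.measure_sum_sq_le (fun i a => X n i j a)
    (L := |K| * p n) (t := (C ^ 2 * |K| + 1) / ε * (n * p n))
    (fun i => (h1 i j).trans (by gcongr; exact le_abs_self K)) (by positivity)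
  refine (measure_mono fun ω hω => ?_).trans (h3.trans (ENNReal.ofReal_le_ofReal ?_))
  · have hω' : Real.sqrt ((C ^ 2 * |K| + 1) / ε) * Real.sqrt (n * p n)
        < ‖∑ i, ξ n i ω • (WithLp.toLp 2 (X n i j) : EuclideanSpace ℝ (Fin (p n)))‖ := by
      simpa using hω
    have := pow_lt_pow_left₀ hω' (by positivity) two_ne_zero
    rw [mul_pow, Real.sq_sqrt (by positivity), Real.sq_sqrt (by positivity),
      EuclideanSpace.real_norm_sq_eq] at this
    simpa using this
  · rw [div_le_iff₀ (by positivity)]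
    have e : ε * ((C ^ 2 * |K| + 1) / ε * (n * p n)) = (C ^ 2 * |K| + 1) * (n * p n) := by
      field_simp
    rw [e]
    nlinarith [mul_pos hn' hp']

end Limits

/-! ### Moments of the cluster weights -/

section Moments

variable {Ω : Type*} [MeasurableSpace Ω] {μ : Measure Ω} {m : ℕ}

/-- A random binary vector `y` whose components follow the logistic model with linear predictors
`θ` and have correlation matrix `R₀`. -/
structure IsBinaryCluster (μ : Measure Ω) (θ : Fin m → ℝ) (R₀ : Matrix (Fin m) (Fin m) ℝ)
    (y : Ω → Fin m → ℝ) : Prop where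
  measurable : ∀ j, Measurable fun ω => y ω j
  binary : ∀ ω j, y ω j = 0 ∨ y ω j = 1
  mean : ∀ j, ∫ ω, y ω j ∂μ = Real.exp (θ j) / (1 + Real.exp (θ j))
  corr : ∀ j k, covariance (fun ω => y ω j) (fun ω => y ω k) μ /
    (Real.sqrt (variance (fun ω => y ω j) μ) * Real.sqrt (variance (fun ω => y ω k) μ)) = R₀ j k

variable {θ : Fin m → ℝ} {R₀ : Matrix (Fin m) (Fin m) ℝ} {y : Ω → Fin m → ℝ}

lemma IsBinaryCluster.abs_le_one (h : IsBinaryCluster μ θ R₀ y) (ω : Ω) (j : Fin m) :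
    |y ω j| ≤ 1 := by
  rcases h.binary ω j with h | h <;> simp [h]

variable [IsProbabilityMeasure μ]

lemma IsBinaryCluster.memLp (h : IsBinaryCluster μ θ R₀ y) (j : Fin m) :
    MemLp (fun ω => y ω j) 2 μ :=
  MemLp.of_bound (h.measurable j).aestronglyMeasurable 1
    (Eventually.of_forall fun ω => h.abs_le_one ω j)

lemma IsBinaryCluster.integrable (h : IsBinaryCluster μ θ R₀ y) (j : Fin m) :
    Integrable (fun ω => y ω j) μ := (h.memLp j).integrable (by norm_num)

lemma IsBinaryCluster.sqrt_variance (h : IsBinaryCluster μ θ R₀ y) (j : Fin m) :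
    Real.sqrt (variance (fun ω => y ω j) μ) = sd (θ j) := by
  have h1 : ∫ ω, ((fun ω => y ω j) ^ 2) ω ∂μ = ∫ ω, y ω j ∂μ := by
    refine integral_congr_ae (Eventually.of_forall fun ω => ?_)
    rcases h.binary ω j with h | h <;> simp [h]
  rw [variance_eq_sub (h.memLp j), h1, h.mean j]
  have h2 := logistic_mul_one_sub (θ j)
  rw [mul_sub, mul_one, ← sq] at h2
  rw [h2, Real.sqrt_sq (sd_pos _).le]

lemma IsBinaryCluster.memLp_res (h : IsBinaryCluster μ θ R₀ y) (j : Fin m) :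
    MemLp (fun ω => res (θ j) (y ω j)) 2 μ := by
  simp only [← inv_sd_mul_sub]
  exact ((h.memLp j).sub (memLp_const _)).const_mul _

lemma IsBinaryCluster.integrable_res (h : IsBinaryCluster μ θ R₀ y) (j : Fin m) :
    Integrable (fun ω => res (θ j) (y ω j)) μ := (h.memLp_res j).integrable (by norm_num)

lemma IsBinaryCluster.integral_res (h : IsBinaryCluster μ θ R₀ y) (j : Fin m) :
    ∫ ω, res (θ j) (y ω j) ∂μ = 0 := by
  simp only [← inv_sd_mul_sub]
  rw [integral_const_mul, integral_sub (h.integrable j) (integrable_const _), h.mean j]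
  simp

lemma IsBinaryCluster.integrable_resDeriv (h : IsBinaryCluster μ θ R₀ y) (j : Fin m) :
    Integrable (fun ω => resDeriv (θ j) (y ω j)) μ := by
  unfold resDeriv
  exact (((h.integrable j).mul_const _).add
    (((integrable_const 1).sub (h.integrable j)).mul_const _)).const_mul _

/-- The expected derivative of the residual is minus the marginal standard deviation. -/
lemma IsBinaryCluster.integral_resDeriv (h : IsBinaryCluster μ θ R₀ y) (j : Fin m) :
    ∫ ω, resDeriv (θ j) (y ω j) ∂μ = -sd (θ j) := by
  rw [← resDeriv_logistic, ← h.mean j]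
  have h1 : Integrable (fun ω => 1 - y ω j) μ := (integrable_const 1).sub (h.integrable j)
  unfold resDeriv
  rw [integral_const_mul, integral_add ((h.integrable j).mul_const _) (h1.mul_const _),
    integral_mul_const, integral_mul_const, integral_sub (integrable_const 1) (h.integrable j)]
  simp

/-- The standardized residuals have the correlation matrix as second moment matrix. -/
lemma IsBinaryCluster.integral_res_mul_res (h : IsBinaryCluster μ θ R₀ y) (j k : Fin m) :
    ∫ ω, res (θ j) (y ω j) * res (θ k) (y ω k) ∂μ = R₀ j k := by
  rw [← h.corr j k, h.sqrt_variance, h.sqrt_variance, covariance, h.mean, h.mean,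
    div_eq_inv_mul, ← integral_const_mul]
  refine integral_congr_ae (Eventually.of_forall fun ω => ?_)
  simp only [← inv_sd_mul_sub, mul_inv]
  ring

/-- The expected Jacobian of the cluster score is `-A^{1/2} W A^{1/2}`. -/
lemma IsBinaryCluster.integral_scoreDeriv (h : IsBinaryCluster μ θ R₀ y)
    (W : Matrix (Fin m) (Fin m) ℝ) (j k : Fin m) :
    ∫ ω, scoreDeriv θ W (y ω) j k ∂μ = -weightH θ W j k := by
  have h1 : Integrable (fun ω => ∑ l, W j l * res (θ l) (y ω l)) μ :=
    integrable_finsetSum _ fun l _ => (h.integrable_res l).const_mul _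
  have h2 : ∫ ω, ∑ l, W j l * res (θ l) (y ω l) ∂μ = 0 := by
    rw [integral_finsetSum _ fun l _ => (h.integrable_res l).const_mul _]
    simp [integral_const_mul, h.integral_res]
  have h3 : Integrable (fun ω => sd (θ j) * (W j k * resDeriv (θ k) (y ω k))) μ :=
    ((h.integrable_resDeriv k).const_mul _).const_mul _
  have h4 : ∫ ω, sd (θ j) * (W j k * resDeriv (θ k) (y ω k)) ∂μ = -weightH θ W j k := by
    rw [integral_const_mul, integral_const_mul, h.integral_resDeriv, weightH]
    ring
  unfold scoreDeriv
  split_ifs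
  · rw [integral_add (h1.const_mul _) h3, integral_const_mul, h2, h4, mul_zero, zero_add]
  · simp only [zero_add]
    exact h4

/-- The expectation of `A^{1/2} W ε εᵀ W A^{1/2}` is `A^{1/2} W R₀ W A^{1/2}`. -/
lemma IsBinaryCluster.integral_weightM (h : IsBinaryCluster μ θ R₀ y)
    (W : Matrix (Fin m) (Fin m) ℝ) (j k : Fin m) :
    ∫ ω, weightM θ W (resOuter θ (y ω)) j k ∂μ = weightM θ W R₀ j k := by
  have h1 : ∀ l l', Integrable (fun ω => resOuter θ (y ω) l l') μ := fun l l' =>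
    (h.memLp_res l).integrable_mul (h.memLp_res l')
  have h2 : ∀ l', Integrable (fun ω => ∑ l, W j l * resOuter θ (y ω) l l') μ := fun l' =>
    integrable_finsetSum _ fun l _ => (h1 l l').const_mul _
  unfold weightM
  rw [integral_mul_const, integral_const_mul,
    integral_finsetSum _ fun l' _ => (h2 l').mul_const _]
  congr 2
  refine Finset.sum_congr rfl fun l' _ => ?_
  rw [integral_mul_const, integral_finsetSum _ fun l _ => (h1 l l').const_mul _]
  congr 1
  refine Finset.sum_congr rfl fun l _ => ?_
  rw [integral_const_mul]
  congr 1
  exact h.integral_res_mul_res l l'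

/-- Bounded functions of independent vectors, minus their means. -/
lemma isCentered_sub_integral {n : ℕ} {Y : Ω → Fin n → Fin m → ℝ}
    (hmeas : ∀ i j, Measurable fun ω => Y ω i j)
    (hindep : iIndepFun (fun (i : Fin n) (ω : Ω) => Y ω i) μ)
    {f : Fin n → (Fin m → ℝ) → ℝ} (hf : ∀ i, Continuous (f i)) {C : ℝ}
    (hC : ∀ i ω, |f i (Y ω i)| ≤ C) {e : Fin n → ℝ} (he : ∀ i, ∫ ω, f i (Y ω i) ∂μ = e i) :
    IsCentered μ (fun i ω => f i (Y ω i) - e i) (2 * C) := by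
  have hm : ∀ i, Measurable fun ω => f i (Y ω i) := fun i =>
    (hf i).measurable.comp (measurable_pi_lambda _ (hmeas i))
  have hint : ∀ i, Integrable (fun ω => f i (Y ω i)) μ := fun i =>
    Integrable.of_bound (hm i).aestronglyMeasurable C (Eventually.of_forall (hC i))
  refine ⟨fun i => (hm i).sub_const _, ?_, fun i => ?_, fun i ω => ?_⟩
  · exact hindep.comp (fun i v => f i v - e i) fun i => (hf i).measurable.sub_const _
  · rw [integral_sub (hint i) (integrable_const _), he]
    simp
  · have h1 : |e i| ≤ C := by
      rw [← he i]
      have := norm_integral_le_of_norm_le_const (μ := μ) (f := fun ω => f i (Y ω i))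
        (Eventually.of_forall (hC i))
      simpa using this
    have := abs_sub (f i (Y ω i)) (e i)
    linarith [hC i ω]

end Moments

/-! ### Regular samples -/

section Regular

open scoped Matrix.Norms.L2Operator

/-- The bounds on a sample of size `n`, all with constants free of `n`, under which the asymptotic
analysis is carried out: the eigenvalues of the Gram matrix of the design are between `b * n` and
`b' * n`, the rows have square norm at most `K * p`, the true linear predictors are at most `L`, and
the inverse `Rbar⁻¹` has entries bounded by `κ` and is coercive with constant `w`. -/
structure IsRegular {n m p : ℕ} (X : Fin n → Matrix (Fin m) (Fin p) ℝ)
    (β₀ : EuclideanSpace ℝ (Fin p)) (Rbar : Matrix (Fin m) (Fin m) ℝ) (b b' K L κ w : ℝ) :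
    Prop where
  n_pos : 0 < n
  gram_lower : ∀ v : EuclideanSpace ℝ (Fin p),
    b * n * ‖v‖ ^ 2 ≤ ∑ i, ∑ j, (X i *ᵥ v.ofLp) j ^ 2
  gram_upper : ∀ v : EuclideanSpace ℝ (Fin p),
    ∑ i, ∑ j, (X i *ᵥ v.ofLp) j ^ 2 ≤ b' * n * ‖v‖ ^ 2
  rows : ∀ i j, ∑ a, X i j a ^ 2 ≤ K * p
  pred : ∀ i j, |(X i *ᵥ β₀.ofLp) j| ≤ L
  entries : ∀ j k, |Rbar⁻¹ j k| ≤ κ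
  coercive : ∀ v : EuclideanSpace ℝ (Fin m), w * ‖v‖ ^ 2 ≤ v.ofLp ⬝ᵥ Rbar⁻¹ *ᵥ v.ofLp

variable {n m p : ℕ} {X : Fin n → Matrix (Fin m) (Fin p) ℝ} {β₀ : EuclideanSpace ℝ (Fin p)}
  {Rbar : Matrix (Fin m) (Fin m) ℝ} {b b' K L κ w : ℝ}

lemma IsRegular.abs_pred_sub_le (h : IsRegular X β₀ Rbar b b' K L κ w)
    (β β' : EuclideanSpace ℝ (Fin p)) (i : Fin n) (j : Fin m) :
    |(X i *ᵥ β.ofLp) j - (X i *ᵥ β'.ofLp) j| ≤ Real.sqrt (K * p) * ‖β - β'‖ := by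
  have h1 := dotProduct_le_norm_mul_norm (WithLp.toLp 2 (X i j)) (β - β')
  have h2 : (X i *ᵥ β.ofLp) j - (X i *ᵥ β'.ofLp) j = X i j ⬝ᵥ (β - β').ofLp := by
    rw [WithLp.ofLp_sub, dotProduct_sub]; rfl
  rw [h2]
  refine h1.trans ?_
  gcongr
  refine Real.le_sqrt_of_sq_le ?_
  rw [EuclideanSpace.real_norm_sq_eq]
  exact h.rows i j

/-- A lower bound on the marginal standard deviation for linear predictors at most `L`. -/
def sdMin (L : ℝ) : ℝ := (2 * Real.exp (|L| / 2))⁻¹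

lemma sdMin_pos (L : ℝ) : 0 < sdMin L := by unfold sdMin; positivity

lemma sdMin_le {L t : ℝ} (h : |t| ≤ L) : sdMin L ≤ sd t := by
  unfold sdMin sd
  have := abs_le.1 (h.trans (le_abs_self L))
  refine inv_anti₀ (by positivity) ?_
  have h1 : Real.exp (t / 2) ≤ Real.exp (|L| / 2) := Real.exp_le_exp.2 (by linarith [this.2])
  have h2 : Real.exp (-(t / 2)) ≤ Real.exp (|L| / 2) := Real.exp_le_exp.2 (by linarith [this.1])
  linarith

lemma IsRegular.coercive_matH (h : IsRegular X β₀ Rbar b b' K L κ w) (hw : 0 ≤ w)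
    (v : EuclideanSpace ℝ (Fin p)) :
    w * sdMin L ^ 2 * b * n * ‖v‖ ^ 2 ≤ v.ofLp ⬝ᵥ matH Rbar X β₀ *ᵥ v.ofLp := by
  have := GEE.coercive_matH hw (sdMin_pos L).le h.gram_lower Rbar h.coercive β₀
    (fun i j => sdMin_le (h.pred i j)) v
  rwa [← mul_assoc] at this

/-- Closeness of the parameter and of the inverse working correlation to their targets makes every
continuous weighted design matrix close, relative to `n`. -/
lemma exists_norm_weighted_sub_le
    (F : (Fin m → ℝ) → Matrix (Fin m) (Fin m) ℝ → (Fin m → ℝ) → Fin m → Fin m → ℝ)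
    (hF : Continuous fun q : (Fin m → ℝ) × (Fin m → Fin m → ℝ) × (Fin m → ℝ) =>
      F q.1 (Matrix.of q.2.1) q.2.2)
    (b b' K L κ w δ : ℝ) (hb' : 0 < b') (hδ : 0 < δ) :
    ∃ η, 0 < η ∧ ∀ (n p : ℕ) (X : Fin n → Matrix (Fin m) (Fin p) ℝ)
      (β₀ β : EuclideanSpace ℝ (Fin p)) (Rbar R : Matrix (Fin m) (Fin m) ℝ)
      (Y : Fin n → Fin m → ℝ),
      IsRegular X β₀ Rbar b b' K L κ w → (∀ i j, |Y i j| ≤ 1) →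
      Real.sqrt (K * p) * ‖β - β₀‖ ≤ η → frobNorm (R⁻¹ - Rbar⁻¹) ≤ η →
      ‖∑ i, (X i)ᵀ * Matrix.of (F (X i *ᵥ β.ofLp) R⁻¹ (Y i)) * X i
        - ∑ i, (X i)ᵀ * Matrix.of (F (X i *ᵥ β₀.ofLp) Rbar⁻¹ (Y i)) * X i‖ ≤ δ * n := by
  set δ' := δ / ((m + 1) * b') with hδ'
  have hδ'0 : 0 < δ' := by positivity
  obtain ⟨η, hη, h⟩ := exists_forall_abs_sub_le F hF L κ δ' hδ'0
  refine ⟨η, hη, fun n p X β₀ β Rbar R Y hreg hY hβ hR => ?_⟩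
  have := norm_sum_weighted_sub_le (Λ := b' * n) (by positivity) hδ'0.le hreg.gram_upper
    (fun i => Matrix.of (F (X i *ᵥ β.ofLp) R⁻¹ (Y i)))
    (fun i => Matrix.of (F (X i *ᵥ β₀.ofLp) Rbar⁻¹ (Y i)))
    (fun i j k => h _ _ _ _ _ (hreg.pred i) hreg.entries (hY i)
      (fun j => (hreg.abs_pred_sub_le β β₀ i j).trans hβ)
      (fun j k => (abs_entry_le_frobNorm (R⁻¹ - Rbar⁻¹) j k).trans hR) j k)
  refine this.trans ?_
  calc δ' * m * (b' * n) ≤ δ' * (m + 1) * (b' * n) := by gcongr; linarith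
    _ = δ * n := by rw [hδ']; field_simp

/-! ### Stability of the sandwich -/

/-- Deterministic core of the consistency of the sandwich estimator. The random input is reduced to
three smallness conditions: on the parameter, on the inverse working correlation and on the centred
middle matrix at the true parameter. -/
lemma exists_sandwich_stability (b b' K L κ w c ε : ℝ) (hb : 0 < b) (hb' : 0 < b') (hw : 0 < w)
    (hc : 0 < c) (hε : 0 < ε) :
    ∃ η, 0 < η ∧ ∀ (n p : ℕ) (X : Fin n → Matrix (Fin m) (Fin p) ℝ)
      (β₀ β : EuclideanSpace ℝ (Fin p)) (Rbar R R₀ : Matrix (Fin m) (Fin m) ℝ)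
      (Y : Fin n → Fin m → ℝ),
      IsRegular X β₀ Rbar b b' K L κ w → (∀ i j, |Y i j| ≤ 1) →
      (∀ i j k, |weightM (X i *ᵥ β₀.ofLp) Rbar⁻¹ R₀ j k| ≤ c) →
      Real.sqrt (K * p) * ‖β - β₀‖ ≤ η → frobNorm (R⁻¹ - Rbar⁻¹) ≤ η →
      ‖∑ i, (X i)ᵀ * Matrix.of (fun j k =>
          weightM (X i *ᵥ β₀.ofLp) Rbar⁻¹ (resOuter (X i *ᵥ β₀.ofLp) (Y i)) j k
            - weightM (X i *ᵥ β₀.ofLp) Rbar⁻¹ R₀ j k) * X i‖ ≤ η * n →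
      IsUnit (matH R X β).det ∧ ‖sigmaHat R X Y β - sigma Rbar R₀ X β₀‖ ≤ ε * (n : ℝ)⁻¹ := by
  set κH := w * sdMin L ^ 2 * b with hκH
  have hs := sdMin_pos L
  have hκH0 : 0 < κH := by positivity
  -- the perturbed matrix keeps half of the coercivity constant `κH * n`, whence the factor `2`
  set cH := 2 * κH⁻¹ with hcH
  have hcH0 : 0 < cH := by positivity
  set cM := c * m * b' with hcM
  have hcM0 : 0 ≤ cM := by positivity
  set A := cH ^ 2 + 2 * cH ^ 3 * cM with hA
  have hA0 : 0 < A := by positivity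
  set δ := min (κH / 2) (ε / A) with hδ
  have hδ0 : 0 < δ := lt_min (by positivity) (by positivity)
  obtain ⟨η₁, hη₁, h₁⟩ := exists_norm_weighted_sub_le (m := m)
    (fun θ W _ => weightH θ W) continuous_weightH b b' K L κ w δ hb' hδ0
  obtain ⟨η₂, hη₂, h₂⟩ := exists_norm_weighted_sub_le (m := m)
    (fun θ W y => weightM θ W (resOuter θ y)) continuous_weightM_resOuter b b' K L κ w (δ / 2) hb'
    (half_pos hδ0)
  refine ⟨min (min η₁ η₂) (δ / 2), by positivity,
    fun n p X β₀ β Rbar R R₀ Y hreg hY hR₀ hβ hR hM => ?_⟩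
  have hn : (0 : ℝ) < n := by exact_mod_cast hreg.n_pos
  have hHd : ‖matH R X β - matH Rbar X β₀‖ ≤ δ * n := by
    rw [matH_eq, matH_eq]
    exact h₁ n p X β₀ β Rbar R Y hreg hY (hβ.trans ((min_le_left _ _).trans (min_le_left _ _)))
      (hR.trans ((min_le_left _ _).trans (min_le_left _ _)))
  have hco := hreg.coercive_matH hw.le
  have hκn : 0 < κH * n := by positivity
  obtain ⟨hu, hi⟩ := isUnit_det_and_norm_inv_le hκn hco
  obtain ⟨hu', hi'⟩ := isUnit_det_and_norm_inv_le (half_pos hκn) (coercive_of_norm_sub_le hco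
    (hHd.trans (by
      have : δ * n ≤ κH / 2 * n := by gcongr; exact min_le_left _ _
      linarith)))
  have e1 : (κH * n)⁻¹ ≤ cH / n := by
    rw [hcH, mul_inv, div_eq_mul_inv]
    gcongr
    linarith [inv_pos.2 hκH0]
  have e2 : (κH * n / 2)⁻¹ ≤ cH / n := by
    rw [hcH]; apply le_of_eq; field_simp
  have hMb : ‖matM Rbar (fun _ => R₀) X β₀‖ ≤ cM * n := by
    rw [matM_eq]
    refine (norm_sum_weighted_le (Λ := b' * n) (by positivity) hc.le hreg.gram_upper
      (fun i => Matrix.of (weightM (X i *ᵥ β₀.ofLp) Rbar⁻¹ R₀)) hR₀).trans (le_of_eq ?_)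
    rw [hcM]; ring
  have hMd : ‖matM R (fun i => Matrix.vecMulVec (resid (X i) (Y i) β) (resid (X i) (Y i) β)) X β
      - matM Rbar (fun _ => R₀) X β₀‖ ≤ δ * n := by
    have d1 := h₂ n p X β₀ β Rbar R Y hreg hY
      (hβ.trans ((min_le_left _ _).trans (min_le_right _ _)))
      (hR.trans ((min_le_left _ _).trans (min_le_right _ _)))
    have d2 : ‖∑ i, (X i)ᵀ * Matrix.of (weightM (X i *ᵥ β₀.ofLp) Rbar⁻¹
        (resOuter (X i *ᵥ β₀.ofLp) (Y i))) * X i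
        - ∑ i, (X i)ᵀ * Matrix.of (weightM (X i *ᵥ β₀.ofLp) Rbar⁻¹ R₀) * X i‖ ≤ δ / 2 * n := by
      rw [← Finset.sum_sub_distrib]
      simp only [← Matrix.sub_mul, ← Matrix.mul_sub]
      exact hM.trans (by gcongr; exact min_le_right _ _)
    simp only [vecMulVec_resid]
    rw [matM_eq, matM_eq]
    calc _ ≤ _ := norm_sub_le_norm_sub_add_norm_sub _ _ _
      _ ≤ δ / 2 * n + δ / 2 * n := add_le_add d1 d2
      _ = δ * n := by ring
  refine ⟨hu', ?_⟩
  refine (norm_sandwich_sub_le hn hcH0.le hcM0 hδ0.le hu hu' (hi.trans e1) (hi'.trans e2) hMb hHd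
    hMd).trans ?_
  rw [div_eq_mul_inv]
  gcongr
  calc A * δ ≤ A * (ε / A) := by gcongr; exact min_le_right _ _
    _ = ε := by field_simp

/-! ### Roots of the estimating equation -/

/-- One step of the simplified Newton iteration for the estimating equation, with the derivative
frozen at its limit `-H` at the true parameter. -/
def newtonStep (Rbar : Matrix (Fin m) (Fin m) ℝ) (X : Fin n → Matrix (Fin m) (Fin p) ℝ)
    (β₀ : EuclideanSpace ℝ (Fin p)) (R : Matrix (Fin m) (Fin m) ℝ) (Y : Fin n → Fin m → ℝ)
    (β : EuclideanSpace ℝ (Fin p)) : EuclideanSpace ℝ (Fin p) :=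
  β + WithLp.toLp 2 ((matH Rbar X β₀)⁻¹ *ᵥ estFun R X Y β)

/-- Deterministic core of the existence of a root: if the centred Jacobian at the true parameter is
small and the estimating function at the true parameter is small enough, the simplified Newton
iteration started there is a contraction and its limit is a root at a distance controlled by the
initial value. -/
lemma exists_newton_convergence (b b' K L κ w : ℝ) (hb : 0 < b) (hb' : 0 < b') (hK : 0 < K)
    (hw : 0 < w) :
    ∃ η c, 0 < η ∧ 0 < c ∧ ∀ (n p : ℕ) (X : Fin n → Matrix (Fin m) (Fin p) ℝ)
      (β₀ : EuclideanSpace ℝ (Fin p)) (Rbar R : Matrix (Fin m) (Fin m) ℝ)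
      (Y : Fin n → Fin m → ℝ), 0 < p →
      IsRegular X β₀ Rbar b b' K L κ w → (∀ i j, |Y i j| ≤ 1) →
      frobNorm (R⁻¹ - Rbar⁻¹) ≤ η →
      ‖∑ i, (X i)ᵀ * Matrix.of (fun j k =>
          scoreDeriv (X i *ᵥ β₀.ofLp) Rbar⁻¹ (Y i) j k
            - -weightH (X i *ᵥ β₀.ofLp) Rbar⁻¹ j k) * X i‖ ≤ η * n →
      Real.sqrt p * ‖WithLp.toLp 2 (estFun R X Y β₀)‖ ≤ η * n →
      ∃ β, Tendsto (fun k => (newtonStep Rbar X β₀ R Y)^[k] β₀) atTop (𝓝 β) ∧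
        estFun R X Y β = 0 ∧ ‖β - β₀‖ ≤ c * (‖WithLp.toLp 2 (estFun R X Y β₀)‖ / n) := by
  set κH := w * sdMin L ^ 2 * b with hκH
  have hs := sdMin_pos L
  have hκH0 : 0 < κH := by positivity
  -- the linearization error and the centred Jacobian may each use up `κH / 4 * n`, so that after
  -- multiplication by `H⁻¹` the contraction constant is `1 / 2`
  set δ := κH / (4 * ((m + 1) * b')) with hδ
  have hδ0 : 0 < δ := by positivity
  obtain ⟨η₁, hη₁, h₁⟩ := exists_score_linearization (m := m) L κ δ hδ0
  set η := min η₁ (min (κH / 4) (κH * η₁ / (2 * Real.sqrt K))) with hη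
  have hK' : 0 < Real.sqrt K := Real.sqrt_pos.2 hK
  refine ⟨η, 2 * κH⁻¹, by positivity, by positivity,
    fun n p X β₀ Rbar R Y hp hreg hY hR hJ hS => ?_⟩
  have hn : (0 : ℝ) < n := by exact_mod_cast hreg.n_pos
  have hp' : 0 < Real.sqrt (p : ℝ) := Real.sqrt_pos.2 (by exact_mod_cast hp)
  have hco := hreg.coercive_matH hw.le
  have hκn : 0 < κH * n := by positivity
  obtain ⟨hu, hi⟩ := isUnit_det_and_norm_inv_le hκn hco
  set T := newtonStep Rbar X β₀ R Y with hT
  -- within this radius the linear predictors move by at most `η₁`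
  set ρ := η₁ / (Real.sqrt K * Real.sqrt p) with hρ
  have hρ0 : 0 < ρ := by positivity
  have hpred : ∀ β ∈ Metric.closedBall β₀ ρ, ∀ i j,
      |(X i *ᵥ β.ofLp) j - (X i *ᵥ β₀.ofLp) j| ≤ η₁ := by
    intro β hβ i j
    refine (hreg.abs_pred_sub_le β β₀ i j).trans ?_
    rw [mem_closedBall_iff_norm] at hβ
    calc _ ≤ Real.sqrt (K * p) * ρ := by gcongr
      _ = η₁ := by rw [Real.sqrt_mul hK.le, hρ]; field_simp
  have hlip : ∀ β ∈ Metric.closedBall β₀ ρ, ∀ β' ∈ Metric.closedBall β₀ ρ,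
      ‖T β - T β'‖ ≤ 1 / 2 * ‖β - β'‖ := by
    intro β hβ β' hβ'
    set d := β - β' with hd
    set u : Fin n → Fin m → ℝ := fun i j => score (X i *ᵥ β.ofLp) R⁻¹ (Y i) j
      - score (X i *ᵥ β'.ofLp) R⁻¹ (Y i) j
      - ∑ k, scoreDeriv (X i *ᵥ β₀.ofLp) Rbar⁻¹ (Y i) j k * (X i *ᵥ d.ofLp) k with hu_def
    set J : Matrix (Fin p) (Fin p) ℝ := ∑ i, (X i)ᵀ * Matrix.of (fun j k =>
          scoreDeriv (X i *ᵥ β₀.ofLp) Rbar⁻¹ (Y i) j k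
            - -weightH (X i *ᵥ β₀.ofLp) Rbar⁻¹ j k) * X i with hJ_def
    have hXd : ∀ i k, (X i *ᵥ d.ofLp) k = (X i *ᵥ β.ofLp) k - (X i *ᵥ β'.ofLp) k := by
      intro i k
      rw [hd, WithLp.ofLp_sub, Matrix.mulVec_sub, Pi.sub_apply]
    have hu_le : ‖WithLp.toLp 2 (∑ i, (X i)ᵀ *ᵥ u i)‖ ≤ δ * m * (b' * n) * ‖d‖ := by
      refine norm_sum_transpose_mulVec_le (by positivity) hδ0.le hreg.gram_upper u d fun i j => ?_
      simp only [hu_def, hXd]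
      exact h₁ _ _ _ _ _ _ (hreg.pred i) hreg.entries (hY i) (hpred β hβ i) (hpred β' hβ' i)
        (fun j k => (abs_entry_le_frobNorm (R⁻¹ - Rbar⁻¹) j k).trans
          (hR.trans (min_le_left _ _))) j
    -- the increment of the Newton map is `H⁻¹` applied to linearization error plus centred Jacobian
    have hvec : matH Rbar X β₀ *ᵥ d.ofLp + (estFun R X Y β - estFun R X Y β')
        = (∑ i, (X i)ᵀ *ᵥ u i) + J *ᵥ d.ofLp := by
      rw [matH_eq, estFun_eq, estFun_eq, hJ_def, Matrix.sum_mulVec, Matrix.sum_mulVec,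
        ← Finset.sum_sub_distrib, ← Finset.sum_add_distrib, ← Finset.sum_add_distrib]
      refine Finset.sum_congr rfl fun i _ => ?_
      simp only [← Matrix.mulVec_mulVec, Matrix.mul_assoc, ← Matrix.mulVec_sub,
        ← Matrix.mulVec_add]
      congr 1
      ext j
      simp only [Pi.add_apply, Pi.sub_apply, hu_def, Matrix.mulVec, dotProduct, Matrix.of_apply]
      simp only [sub_neg_eq_add, add_mul, Finset.sum_add_distrib]
      ring
    have hTd : T β - T β' = WithLp.toLp 2 ((matH Rbar X β₀)⁻¹ *ᵥ
        (WithLp.toLp 2 ((∑ i, (X i)ᵀ *ᵥ u i) + J *ᵥ d.ofLp) : EuclideanSpace ℝ (Fin p)).ofLp) := by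
      rw [← hvec, hT, newtonStep, newtonStep]
      ext a
      have e : (matH Rbar X β₀)⁻¹ *ᵥ (matH Rbar X β₀ *ᵥ d.ofLp) = d.ofLp := by
        rw [Matrix.mulVec_mulVec, Matrix.nonsing_inv_mul _ hu, Matrix.one_mulVec]
      simp only [Matrix.mulVec_add, Matrix.mulVec_sub, e]
      simp only [PiLp.sub_apply, PiLp.add_apply, Pi.add_apply, Pi.sub_apply, hd]
      ring
    rw [hTd]
    refine (norm_mulVec_le _ _).trans ?_
    have hsum : ‖(WithLp.toLp 2 ((∑ i, (X i)ᵀ *ᵥ u i) + J *ᵥ d.ofLp) : EuclideanSpace ℝ (Fin p))‖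
        ≤ κH * n / 2 * ‖d‖ := by
      rw [WithLp.toLp_add]
      refine (norm_add_le _ _).trans ?_
      have q1 : δ * m * (b' * n) * ‖d‖ ≤ κH / 4 * n * ‖d‖ := by
        gcongr ?_ * ‖d‖
        calc δ * m * (b' * n) ≤ δ * (m + 1) * (b' * n) := by gcongr; linarith
          _ = κH / 4 * n := by rw [hδ]; field_simp
      have q2 : ‖(WithLp.toLp 2 (J *ᵥ d.ofLp) : EuclideanSpace ℝ (Fin p))‖ ≤ κH / 4 * n * ‖d‖ := by
        refine (norm_mulVec_le J d).trans ?_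
        gcongr
        refine hJ.trans ?_
        gcongr
        exact (min_le_right _ _).trans (min_le_left _ _)
      linarith
    calc _ ≤ (κH * n)⁻¹ * (κH * n / 2 * ‖d‖) := by gcongr
      _ = 1 / 2 * ‖d‖ := by field_simp
  set s := ‖(WithLp.toLp 2 (estFun R X Y β₀) : EuclideanSpace ℝ (Fin p))‖ with hs_def
  have hT0 : ‖T β₀ - β₀‖ ≤ (κH * n)⁻¹ * s := by
    rw [hT, newtonStep, add_sub_cancel_left]
    refine (norm_mulVec_le _ (WithLp.toLp 2 (estFun R X Y β₀))).trans ?_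
    gcongr
  have hT0' : ‖T β₀ - β₀‖ ≤ ρ / 2 := by
    refine hT0.trans ?_
    rw [inv_mul_le_iff₀ hκn]
    have q1 : Real.sqrt p * s ≤ κH * η₁ / (2 * Real.sqrt K) * n :=
      hS.trans (by gcongr; exact (min_le_right _ _).trans (min_le_right _ _))
    have q2 : κH * n * (ρ / 2) = κH * η₁ / (2 * Real.sqrt K) * n / Real.sqrt p := by
      rw [hρ]; field_simp
    rw [q2, le_div_iff₀ hp', mul_comm]
    exact q1
  have hmaps : Set.MapsTo T (Metric.closedBall β₀ ρ) (Metric.closedBall β₀ ρ) := by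
    intro β hβ
    have q := hlip β hβ β₀ (Metric.mem_closedBall_self hρ0.le)
    rw [mem_closedBall_iff_norm] at hβ ⊢
    calc ‖T β - β₀‖ ≤ ‖T β - T β₀‖ + ‖T β₀ - β₀‖ := norm_sub_le_norm_sub_add_norm_sub _ _ _
      _ ≤ 1 / 2 * ‖β - β₀‖ + ρ / 2 := add_le_add q hT0'
      _ ≤ ρ := by linarith
  have hcontr : ContractingWith (1 / 2) (hmaps.restrict T _ _) := by
    refine ⟨by norm_num [← NNReal.coe_lt_coe], LipschitzWith.of_dist_le_mul fun x y => ?_⟩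
    rw [Subtype.dist_eq, Subtype.dist_eq, dist_eq_norm, dist_eq_norm]
    simpa using hlip x x.2 y y.2
  obtain ⟨β, hβ, hfix, hlim, -⟩ := hcontr.exists_fixedPoint'
    Metric.isClosed_closedBall.isComplete hmaps
    (Metric.mem_closedBall_self hρ0.le) (edist_ne_top _ _)
  refine ⟨β, hlim, ?_, ?_⟩
  · have q : (matH Rbar X β₀)⁻¹ *ᵥ estFun R X Y β = 0 := by
      have q1 : T β = β := hfix
      rw [hT, newtonStep, add_eq_left] at q1
      exact congrArg WithLp.ofLp q1
    have q2 := congrArg (fun v => matH Rbar X β₀ *ᵥ v) q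
    simpa [Matrix.mulVec_mulVec, Matrix.mul_nonsing_inv _ hu] using q2
  · have q := hlip β hβ β₀ (Metric.mem_closedBall_self hρ0.le)
    have q1 : T β = β := hfix
    have q2 : ‖β - β₀‖ ≤ ‖T β - T β₀‖ + ‖T β₀ - β₀‖ := by
      have := norm_sub_le_norm_sub_add_norm_sub (T β) (T β₀) β₀
      rwa [q1] at this ⊢
    have q3 : ‖β - β₀‖ ≤ 2 * ((κH * n)⁻¹ * s) := by linarith
    refine q3.trans (le_of_eq ?_)
    rw [mul_inv]; ring

end Regular

/-! ### Measurability of the Newton iterates -/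

section Measurability

variable {Ω : Type*} [MeasurableSpace Ω] {m n p : ℕ}

lemma measurable_det {A : Ω → Matrix (Fin m) (Fin m) ℝ}
    (hA : ∀ j k, Measurable fun ω => A ω j k) : Measurable fun ω => (A ω).det := by
  simp only [Matrix.det_apply']
  exact Finset.measurable_fun_sum _ fun σ _ =>
    (Finset.measurable_fun_prod _ fun i _ => hA _ _).const_mul _

lemma measurable_inv_apply {A : Ω → Matrix (Fin m) (Fin m) ℝ}
    (hA : ∀ j k, Measurable fun ω => A ω j k) (j k : Fin m) :
    Measurable fun ω => (A ω)⁻¹ j k := by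
  simp only [Matrix.inv_def, Ring.inverse_eq_inv', Matrix.smul_apply, smul_eq_mul,
    Matrix.adjugate_apply]
  refine (measurable_det hA).inv.mul (measurable_det fun a b => ?_)
  by_cases h : a = k
  · subst h; simp
  · simpa [Matrix.updateRow_ne h] using hA a b

lemma measurable_newtonStep_iterate (Rbar : Matrix (Fin m) (Fin m) ℝ)
    (X : Fin n → Matrix (Fin m) (Fin p) ℝ) (β₀ : EuclideanSpace ℝ (Fin p))
    {R : Ω → Matrix (Fin m) (Fin m) ℝ} {Y : Ω → Fin n → Fin m → ℝ}
    (hR : ∀ j k, Measurable fun ω => R ω j k) (hY : ∀ i j, Measurable fun ω => Y ω i j) (k : ℕ) :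
    Measurable fun ω => (newtonStep Rbar X β₀ (R ω) (Y ω))^[k] β₀ := by
  induction k with
  | zero => exact measurable_const
  | succ k ih =>
    simp only [Function.iterate_succ_apply']
    set β := fun ω => (newtonStep Rbar X β₀ (R ω) (Y ω))^[k] β₀ with hβ
    have hpred : ∀ i j, Measurable fun ω => (X i *ᵥ (β ω).ofLp) j := by
      intro i j
      simp only [Matrix.mulVec, dotProduct]
      exact Finset.measurable_fun_sum _ fun a _ =>
        (((EuclideanSpace.proj (𝕜 := ℝ) a).continuous.measurable).comp ih).const_mul _
    have hscore : ∀ i j, Measurable fun ω => score (X i *ᵥ (β ω).ofLp) (R ω)⁻¹ (Y ω i) j := by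
      intro i j
      unfold score
      refine (continuous_sd.measurable.comp (hpred i j)).mul
        (Finset.measurable_fun_sum _ fun l _ => (measurable_inv_apply hR j l).mul ?_)
      have h1 := hpred i l
      have h2 := hY i l
      unfold res
      fun_prop
    have hest : ∀ a, Measurable fun ω => estFun (R ω) X (Y ω) (β ω) a := by
      intro a
      simp only [estFun_eq, Finset.sum_apply, Matrix.mulVec, dotProduct]
      exact Finset.measurable_fun_sum _ fun i _ => Finset.measurable_fun_sum _ fun j _ =>
        (hscore i j).const_mul _
    refine ih.add ((WithLp.measurable_toLp 2 _).comp (measurable_pi_lambda _ fun a => ?_))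
    simp only [Matrix.mulVec, dotProduct]
    exact Finset.measurable_fun_sum _ fun b _ => (hest b).const_mul _

end Measurability

/-! ### Asymptotics -/

section Asymptotics

open scoped Matrix.Norms.L2Operator

variable {Ω : ℕ → Type*} [∀ n, MeasurableSpace (Ω n)] {P : ∀ n, Measure (Ω n)} {m : ℕ} {p : ℕ → ℕ}
  {X : ∀ n, Fin n → Matrix (Fin m) (Fin (p n)) ℝ} {Y : ∀ n, Ω n → Fin n → Fin m → ℝ}
  {β₀ : ∀ n, EuclideanSpace ℝ (Fin (p n))} {R₀ : ℕ → Matrix (Fin m) (Fin m) ℝ}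
  {Rhat : ∀ n, Ω n → Matrix (Fin m) (Fin m) ℝ} {Rbar : ℕ → Matrix (Fin m) (Fin m) ℝ}
  {b b' K L κ w : ℝ}

/-- The growth condition in the form in which it enters: `√p` from the rows of the design times
`√(p / n)` from the parameter. -/
lemma tendsto_div_sqrt (hp : ∀ n, 0 < p n)
    (hdim : Tendsto (fun n => (p n : ℝ) ^ 3 / n) atTop (𝓝 0)) :
    Tendsto (fun n => (p n : ℝ) / Real.sqrt n) atTop (𝓝 0) := by
  have h1 : Tendsto (fun n => Real.sqrt ((p n : ℝ) ^ 3 / n)) atTop (𝓝 0) := by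
    have := (Real.continuous_sqrt.tendsto 0).comp hdim
    rwa [Real.sqrt_zero] at this
  refine squeeze_zero (fun n => by positivity) (fun n => ?_) h1
  rw [Real.sqrt_div (by positivity)]
  gcongr
  refine Real.le_sqrt_of_sq_le ?_
  have : (1 : ℝ) ≤ p n := by exact_mod_cast hp n
  exact pow_le_pow_right₀ this (by norm_num)

/-- The assumptions on covariates, probabilities, design and working correlation make the samples
eventually regular, with constants free of `n`. -/
lemma exists_eventually_isRegular
    (hXbound : ∃ K : ℝ, ∀ᶠ n in atTop, ∀ i j,
      ‖(WithLp.toLp 2 (X n i j) : EuclideanSpace ℝ (Fin (p n)))‖ ≤ K * Real.sqrt (p n))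
    (hprob : ∃ b₁ b₂ : ℝ, 0 < b₁ ∧ b₂ < 1 ∧ ∀ᶠ n in atTop, ∀ i j,
      b₁ ≤ prob (X n i) (β₀ n) j ∧ prob (X n i) (β₀ n) j ≤ b₂)
    (hdesign : ∃ b₃ b₄ : ℝ, 0 < b₃ ∧ 0 < b₄ ∧ ∀ᶠ n : ℕ in atTop,
      spectrum ℝ ((n : ℝ)⁻¹ • ∑ i, (X n i)ᵀ * X n i) ⊆ Set.Icc b₃ b₄)
    (hRbar : ∃ c K : ℝ, 0 < c ∧ ∀ᶠ n in atTop,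
      (Rbar n).PosDef ∧ spectrum ℝ (Rbar n) ⊆ Set.Icc c K) :
    ∃ b b' K L κ w : ℝ, 0 < b ∧ 0 < b' ∧ 0 < K ∧ 0 < w ∧
      ∀ᶠ n in atTop, IsRegular (X n) (β₀ n) (Rbar n) b b' K L κ w := by
  obtain ⟨K₁, hX⟩ := hXbound
  obtain ⟨b₁, b₂, hb₁, hb₂, hprob⟩ := hprob
  obtain ⟨b₃, b₄, hb₃, hb₄, hdesign⟩ := hdesign
  obtain ⟨c, K₂, hc, hRbar⟩ := hRbar
  -- `K₁` and `K₂` may fail to be positive as given, hence `K₁ ^ 2 + 1` and `max K₂ 1`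
  refine ⟨b₃, b₄, K₁ ^ 2 + 1, |Real.log b₁| + |Real.log (1 - b₂)|, c⁻¹, (max K₂ 1)⁻¹, hb₃, hb₄,
    by positivity, by positivity, ?_⟩
  filter_upwards [hX, hprob, hdesign, hRbar, eventually_gt_atTop 0] with n h1 h2 h3 h4 hn
  obtain ⟨h5, h6⟩ := inv_bounds_of_posDef h4.1 hc
    (h4.2.trans (Set.Icc_subset_Icc_right (le_max_left K₂ 1)))
  refine ⟨hn, fun v => (gram_bounds (X n) hn h3 v).1, fun v => (gram_bounds (X n) hn h3 v).2,
    fun i j => ?_, fun i j => abs_le_of_logistic hb₁ hb₂ (h2 i j).1 (h2 i j).2,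
    fun j k => (abs_entry_le_opNorm _ j k).trans h5, h6⟩
  have h7 := pow_le_pow_left₀ (norm_nonneg _) (h1 i j) 2
  rw [EuclideanSpace.real_norm_sq_eq, mul_pow, Real.sq_sqrt (Nat.cast_nonneg _)] at h7
  have h8 : (0 : ℝ) ≤ p n := Nat.cast_nonneg _
  calc _ ≤ K₁ ^ 2 * p n := h7
    _ ≤ _ := by gcongr; linarith

/-- The estimated inverse working correlation is consistent. -/
lemma highProb_frobNorm_le (hp : ∀ n, 0 < p n)
    (hRhatRate : IsBigOp P (fun n ω => frobNorm ((Rhat n ω)⁻¹ - (Rbar n)⁻¹))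
      (fun n => Real.sqrt ((p n : ℝ) / n)))
    (hdim : Tendsto (fun n => (p n : ℝ) / Real.sqrt n) atTop (𝓝 0)) {η : ℝ} (hη : 0 < η) :
    HighProb P fun n => {ω | frobNorm ((Rhat n ω)⁻¹ - (Rbar n)⁻¹) ≤ η} := by
  refine (hRhatRate.highProb (t := fun _ => η) fun C => ?_).mono (Eventually.of_forall
    fun n ω hω => ?_)
  swap
  · rw [Set.mem_ofPred_eq] at hω ⊢
    exact (le_abs_self _).trans hω
  have h1 := (hdim.const_mul |C|).eventually_le_const (u := η) (by simpa using hη)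
  filter_upwards [h1] with n hn
  refine le_trans ?_ hn
  refine mul_le_mul (le_abs_self C) ?_ (Real.sqrt_nonneg _) (abs_nonneg _)
  rw [Real.sqrt_div (Nat.cast_nonneg _)]
  gcongr
  refine Real.sqrt_le_iff.2 ⟨Nat.cast_nonneg _, ?_⟩
  have : (1 : ℝ) ≤ p n := by exact_mod_cast hp n
  nlinarith

variable [∀ n, IsProbabilityMeasure (P n)]

/-- Law of large numbers in operator norm for weighted design matrices whose weights are continuous
functions of the linear predictors, the inverse working correlation and the responses. -/
lemma highProb_norm_weighted_sub_mean
    (hreg : ∀ᶠ n in atTop, IsRegular (X n) (β₀ n) (Rbar n) b b' K L κ w)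
    (hclus : ∀ n i, IsBinaryCluster (P n) (X n i *ᵥ (β₀ n).ofLp) (R₀ n) fun ω => Y n ω i)
    (hindep : ∀ n, iIndepFun (fun (i : Fin n) (ω : Ω n) => Y n ω i) (P n))
    (hdim : Tendsto (fun n => (p n : ℝ) / Real.sqrt n) atTop (𝓝 0))
    (F : (Fin m → ℝ) → Matrix (Fin m) (Fin m) ℝ → (Fin m → ℝ) → Fin m → Fin m → ℝ)
    (hF : Continuous fun q : (Fin m → ℝ) × (Fin m → Fin m → ℝ) × (Fin m → ℝ) =>
      F q.1 (Matrix.of q.2.1) q.2.2)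
    (e : ∀ n, Fin n → Fin m → Fin m → ℝ)
    (he : ∀ n i j k, ∫ ω, F (X n i *ᵥ (β₀ n).ofLp) (Rbar n)⁻¹ (Y n ω i) j k ∂(P n) = e n i j k)
    {δ : ℝ} (hδ : 0 < δ) :
    HighProb P fun n => {ω | ‖∑ i, (X n i)ᵀ * Matrix.of (fun j k =>
      F (X n i *ᵥ (β₀ n).ofLp) (Rbar n)⁻¹ (Y n ω i) j k - e n i j k) * X n i‖ ≤ δ * n} := by
  obtain ⟨C, -, hC⟩ := exists_forall_abs_le F hF L κ
  refine highProb_norm_sum_weighted (C := 2 * C) (K := K) (hreg.mono fun n h => h.rows)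
    (fun n i ω => Matrix.of (fun j k =>
      F (X n i *ᵥ (β₀ n).ofLp) (Rbar n)⁻¹ (Y n ω i) j k - e n i j k)) ?_ ?_ hδ
  · filter_upwards [hreg] with n hn j k
    have hcont : ∀ i, Continuous fun y => F (X n i *ᵥ (β₀ n).ofLp) (Rbar n)⁻¹ y j k := by
      intro i
      have h1 : Continuous fun y : Fin m → ℝ =>
          (X n i *ᵥ (β₀ n).ofLp, Matrix.of.symm (Rbar n)⁻¹, y) := by fun_prop
      exact (continuous_apply_apply j k).comp (hF.comp h1)
    exact isCentered_sub_integral (fun i j => (hclus n i).measurable j) (hindep n)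
      (f := fun i y => F (X n i *ᵥ (β₀ n).ofLp) (Rbar n)⁻¹ y j k) hcont
      (fun i ω => hC _ _ _ (hn.pred i) hn.entries ((hclus n i).abs_le_one ω) j k)
      (fun i => he n i j k)
  · have := hdim.pow 2
    simp only [div_pow, Real.sq_sqrt (Nat.cast_nonneg _)] at this
    simpa using this

/-- The estimating function at the true parameter is `O_p(√(n p))`. -/
lemma isBigOp_norm_estFun (hp : ∀ n, 0 < p n)
    (hreg : ∀ᶠ n in atTop, IsRegular (X n) (β₀ n) (Rbar n) b b' K L κ w)
    (hclus : ∀ n i, IsBinaryCluster (P n) (X n i *ᵥ (β₀ n).ofLp) (R₀ n) fun ω => Y n ω i)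
    (hindep : ∀ n, iIndepFun (fun (i : Fin n) (ω : Ω n) => Y n ω i) (P n))
    (hR : HighProb P fun n => {ω | frobNorm ((Rhat n ω)⁻¹ - (Rbar n)⁻¹) ≤ 1}) :
    IsBigOp P (fun n ω =>
      ‖(WithLp.toLp 2 (estFun (Rhat n ω) (X n) (Y n ω) (β₀ n)) : EuclideanSpace ℝ (Fin (p n)))‖)
      (fun n => Real.sqrt (n * p n)) := by
  set ξ : Fin m × Fin m → ∀ n, Fin n → Ω n → ℝ := fun q n i ω =>
    sd ((X n i *ᵥ (β₀ n).ofLp) q.1) * res ((X n i *ᵥ (β₀ n).ofLp) q.2) (Y n ω i q.2) - 0 with hξ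
  have hF : Continuous fun q : (Fin m → ℝ) × (Fin m → Fin m → ℝ) × (Fin m → ℝ) =>
      fun j k => sd (q.1 j) * res (q.1 k) (q.2.2 k) := by
    have := continuous_sd
    unfold res
    fun_prop
  obtain ⟨C, -, hC⟩ := exists_forall_abs_le
    (fun θ _ y j k => sd (θ j) * res (θ k) (y k)) hF L κ
  have hcen : ∀ q, ∀ᶠ n in atTop, IsCentered (P n) (ξ q n) (2 * C) := by
    intro q
    filter_upwards [hreg] with n hn
    refine isCentered_sub_integral (fun i j => (hclus n i).measurable j) (hindep n)
      (f := fun i y => sd ((X n i *ᵥ (β₀ n).ofLp) q.1) * res ((X n i *ᵥ (β₀ n).ofLp) q.2) (y q.2))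
      (fun i => by unfold res; fun_prop)
      (fun i ω => hC _ (Rbar n)⁻¹ _ (hn.pred i) hn.entries ((hclus n i).abs_le_one ω) q.1 q.2)
      (e := fun _ => 0) (fun i => ?_)
    rw [integral_const_mul, (hclus n i).integral_res, mul_zero]
  have hsum := IsBigOp.sum (P := P) Finset.univ (r := fun n => Real.sqrt (n * p n))
    (fun n => Real.sqrt_nonneg _) fun (q : Fin m × Fin m) _ =>
      isBigOp_norm_sum_rows hp (hreg.mono fun n h => h.rows) q.1 (ξ q) (hcen q)
  refine hsum.of_abs_le (c := |κ| + 1) hR (by positivity) ?_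
  filter_upwards [hreg] with n hn ω hω
  have hW : ∀ j k, |(Rhat n ω)⁻¹ j k| ≤ |κ| + 1 := by
    intro j k
    have h1 := (abs_entry_le_frobNorm ((Rhat n ω)⁻¹ - (Rbar n)⁻¹) j k).trans hω
    have h2 := (hn.entries j k).trans (le_abs_self κ)
    have h3 := abs_add_le ((Rbar n)⁻¹ j k) ((Rhat n ω)⁻¹ j k - (Rbar n)⁻¹ j k)
    rw [add_sub_cancel] at h3
    rw [Matrix.sub_apply] at h1
    linarith
  have heq : (WithLp.toLp 2 (estFun (Rhat n ω) (X n) (Y n ω) (β₀ n)) : EuclideanSpace ℝ (Fin (p n)))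
      = ∑ q : Fin m × Fin m, (Rhat n ω)⁻¹ q.1 q.2 • ∑ i, ξ q n i ω •
        (WithLp.toLp 2 (X n i q.1) : EuclideanSpace ℝ (Fin (p n))) := by
    ext a
    simp only [estFun_eq, WithLp.ofLp_sum, WithLp.ofLp_smul, Finset.sum_apply, Pi.smul_apply,
      smul_eq_mul, hξ, sub_zero, Matrix.mulVec, dotProduct, Matrix.transpose_apply, score]
    simp only [Finset.mul_sum]
    rw [Finset.sum_comm (s := (Finset.univ : Finset (Fin m × Fin m)))]
    refine Finset.sum_congr rfl fun i _ => ?_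
    rw [Fintype.sum_prod_type]
    exact Finset.sum_congr rfl fun j _ => Finset.sum_congr rfl fun k _ => by ring_nf
  rw [heq, abs_of_nonneg (norm_nonneg _), abs_of_nonneg (Finset.sum_nonneg fun _ _ => norm_nonneg _),
    Finset.mul_sum]
  refine (norm_sum_le _ _).trans (Finset.sum_le_sum fun q _ => ?_)
  rw [norm_smul, Real.norm_eq_abs]
  gcongr
  exact hW q.1 q.2

/-- A consistent root of the estimating equation, selected measurably as the limit of the simplified
Newton iteration. -/
lemma exists_isGEEEstimator (hp : ∀ n, 0 < p n) (hb : 0 < b) (hb' : 0 < b') (hK : 0 < K)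
    (hw : 0 < w)
    (hreg : ∀ᶠ n in atTop, IsRegular (X n) (β₀ n) (Rbar n) b b' K L κ w)
    (hclus : ∀ n i, IsBinaryCluster (P n) (X n i *ᵥ (β₀ n).ofLp) (R₀ n) fun ω => Y n ω i)
    (hindep : ∀ n, iIndepFun (fun (i : Fin n) (ω : Ω n) => Y n ω i) (P n))
    (hRhat : ∀ n j k, Measurable fun ω => Rhat n ω j k)
    (hdim : Tendsto (fun n => (p n : ℝ) / Real.sqrt n) atTop (𝓝 0))
    (hR : ∀ η : ℝ, 0 < η → HighProb P fun n => {ω | frobNorm ((Rhat n ω)⁻¹ - (Rbar n)⁻¹) ≤ η}) :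
    ∃ βhat : ∀ n, Ω n → EuclideanSpace ℝ (Fin (p n)), IsGEEEstimator P X Y Rhat β₀ βhat := by
  obtain ⟨η, c, hη, hc, hnewton⟩ := exists_newton_convergence (m := m) b b' K L κ w hb hb' hK hw
  set s : ∀ n, Ω n → ℝ := fun n ω =>
    ‖(WithLp.toLp 2 (estFun (Rhat n ω) (X n) (Y n ω) (β₀ n)) : EuclideanSpace ℝ (Fin (p n)))‖
    with hs
  have hS : IsBigOp P s (fun n => Real.sqrt (n * p n)) :=
    isBigOp_norm_estFun hp hreg hclus hindep (hR 1 one_pos)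
  have hS1 : HighProb P fun n => {ω | Real.sqrt (p n) * s n ω ≤ η * n} := by
    refine (hS.highProb (t := fun n => η * n / Real.sqrt (p n)) fun C => ?_).mono
      (Eventually.of_forall fun n ω hω => ?_)
    · have h1 := (hdim.const_mul C).eventually_le_const (u := η) (by simpa using hη)
      filter_upwards [h1, eventually_gt_atTop 0] with n hn hn0
      have hn' : 0 < Real.sqrt (n : ℝ) := Real.sqrt_pos.2 (by exact_mod_cast hn0)
      have hp' : 0 < Real.sqrt (p n : ℝ) := Real.sqrt_pos.2 (by exact_mod_cast hp n)
      rw [le_div_iff₀ hp', Real.sqrt_mul (Nat.cast_nonneg _)]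
      rw [mul_div_assoc', div_le_iff₀ hn'] at hn
      calc C * (Real.sqrt n * Real.sqrt (p n)) * Real.sqrt (p n)
          = C * (Real.sqrt (p n) * Real.sqrt (p n)) * Real.sqrt n := by ring
        _ = C * p n * Real.sqrt n := by rw [Real.mul_self_sqrt (Nat.cast_nonneg _)]
        _ ≤ η * Real.sqrt n * Real.sqrt n := by gcongr
        _ = η * n := by rw [mul_assoc, Real.mul_self_sqrt (Nat.cast_nonneg _)]
    · have hp' : 0 < Real.sqrt (p n : ℝ) := Real.sqrt_pos.2 (by exact_mod_cast hp n)
      rw [Set.mem_ofPred_eq] at hω ⊢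
      have h1 := (le_abs_self _).trans hω
      rwa [le_div_iff₀ hp', mul_comm] at h1
  have hJ := highProb_norm_weighted_sub_mean hreg hclus hindep hdim scoreDeriv
    continuous_scoreDeriv (fun n i j k => -weightH (X n i *ᵥ (β₀ n).ofLp) (Rbar n)⁻¹ j k)
    (fun n i j k => (hclus n i).integral_scoreDeriv _ j k) hη
  set βhat : ∀ n, Ω n → EuclideanSpace ℝ (Fin (p n)) := fun n ω => limUnder atTop
    fun k => (newtonStep (Rbar n) (X n) (β₀ n) (Rhat n ω) (Y n ω))^[k] (β₀ n) with hβhat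
  have hgood : HighProb P fun n => {ω | estFun (Rhat n ω) (X n) (Y n ω) (βhat n ω) = 0 ∧
      ‖βhat n ω - β₀ n‖ ≤ c * (s n ω / n)} := by
    refine (((hR η hη).inter hJ).inter hS1).mono ?_
    filter_upwards [hreg] with n hn ω hω
    obtain ⟨β, hlim, hroot, hβ⟩ := hnewton n (p n) (X n) (β₀ n) (Rbar n) (Rhat n ω) (Y n ω) (hp n)
      hn (fun i => (hclus n i).abs_le_one ω) hω.1.1 hω.1.2 hω.2
    have he : βhat n ω = β := hlim.limUnder_eq
    exact ⟨by rw [he]; exact hroot, by rw [he]; exact hβ⟩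
  have hS2 : IsBigOp P (fun n ω => s n ω / n) (fun n => Real.sqrt ((p n : ℝ) / n)) := by
    intro ε hε
    obtain ⟨C, hC, h⟩ := hS ε hε
    refine ⟨C, hC, ?_⟩
    filter_upwards [h, eventually_gt_atTop 0] with n h1 hn
    have hn' : (0 : ℝ) < n := by exact_mod_cast hn
    refine (measure_mono fun ω hω => ?_).trans h1
    rw [Set.mem_ofPred_eq, abs_div, abs_of_pos hn', lt_div_iff₀ hn'] at hω
    rw [Set.mem_ofPred_eq]
    refine lt_of_eq_of_lt ?_ hω
    rw [mul_assoc]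
    congr 1
    nth_rewrite 3 [← Real.sqrt_mul_self hn'.le]
    rw [← Real.sqrt_mul (by positivity)]
    congr 1
    field_simp
  refine ⟨βhat, fun n => ?_, ?_, ?_⟩
  · exact (StronglyMeasurable.limUnder fun k => (measurable_newtonStep_iterate (Rbar n) (X n) (β₀ n)
      (hRhat n) (fun i j => (hclus n i).measurable j) k).stronglyMeasurable).measurable
  · exact (hgood.mono (Eventually.of_forall fun n ω hω => hω.1)).tendsto_one
  · refine hS2.of_abs_le hgood hc (Eventually.of_forall fun n ω hω => ?_)
    rw [abs_of_nonneg (norm_nonneg _)]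
    refine hω.2.trans ?_
    gcongr
    exact le_abs_self _

/-- Consistency of the sandwich estimator in operator norm: the rate `√(p / n)` of the
parameter estimator keeps the linear predictors within `o_p(1)` of the true ones. -/
lemma highProb_norm_sigmaHat_sub (hb : 0 < b) (hb' : 0 < b') (hK : 0 < K)
    (hw : 0 < w) (hp : ∀ n, 0 < p n)
    (hreg : ∀ᶠ n in atTop, IsRegular (X n) (β₀ n) (Rbar n) b b' K L κ w)
    (hclus : ∀ n i, IsBinaryCluster (P n) (X n i *ᵥ (β₀ n).ofLp) (R₀ n) fun ω => Y n ω i)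
    (hindep : ∀ n, iIndepFun (fun (i : Fin n) (ω : Ω n) => Y n ω i) (P n))
    (hdim : Tendsto (fun n => (p n : ℝ) / Real.sqrt n) atTop (𝓝 0))
    (hR : ∀ η : ℝ, 0 < η → HighProb P fun n => {ω | frobNorm ((Rhat n ω)⁻¹ - (Rbar n)⁻¹) ≤ η})
    {βhat : ∀ n, Ω n → EuclideanSpace ℝ (Fin (p n))}
    (hrate : IsBigOp P (fun n ω => ‖βhat n ω - β₀ n‖) (fun n => Real.sqrt ((p n : ℝ) / n)))
    {ε : ℝ} (hε : 0 < ε) :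
    HighProb P fun n => {ω | IsUnit (matH (Rhat n ω) (X n) (βhat n ω)).det ∧
      ‖sigmaHat (Rhat n ω) (X n) (Y n ω) (βhat n ω) - sigma (Rbar n) (R₀ n) (X n) (β₀ n)‖
        ≤ ε * (n : ℝ)⁻¹} := by
  obtain ⟨c, hc, hcb⟩ := exists_forall_abs_le (m := m)
    (fun θ W y => weightM θ W (resOuter θ y)) continuous_weightM_resOuter L κ
  obtain ⟨η, hη, hstab⟩ := exists_sandwich_stability (m := m) b b' K L κ w c ε hb hb' hw hc hε
  have hM := highProb_norm_weighted_sub_mean hreg hclus hindep hdim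
    (fun θ W y => weightM θ W (resOuter θ y)) continuous_weightM_resOuter
    (fun n i j k => weightM (X n i *ᵥ (β₀ n).ofLp) (Rbar n)⁻¹ (R₀ n) j k)
    (fun n i j k => (hclus n i).integral_weightM _ j k) hη
  have hβ : HighProb P fun n => {ω | Real.sqrt (K * p n) * ‖βhat n ω - β₀ n‖ ≤ η} := by
    have hpos : ∀ n, 0 < Real.sqrt (K * p n) := fun n =>
      Real.sqrt_pos.2 (mul_pos hK (by exact_mod_cast hp n))
    refine (hrate.highProb (t := fun n => η / Real.sqrt (K * p n)) fun C => ?_).mono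
      (Eventually.of_forall fun n ω hω => ?_)
    · have h1 := (hdim.const_mul (C * Real.sqrt K)).eventually_le_const (u := η) (by simpa using hη)
      filter_upwards [h1] with n hn
      rw [le_div_iff₀ (hpos n), Real.sqrt_mul hK.le, Real.sqrt_div (Nat.cast_nonneg _)]
      calc _ = C * Real.sqrt K * (Real.sqrt (p n) * Real.sqrt (p n) / Real.sqrt n) := by ring
        _ ≤ η := by rwa [Real.mul_self_sqrt (Nat.cast_nonneg _)]
    · rw [Set.mem_ofPred_eq] at hω ⊢
      have h1 := (le_abs_self _).trans hω
      rwa [le_div_iff₀ (hpos n), mul_comm] at h1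
  refine ((hM.inter hβ).inter (hR η hη)).mono ?_
  filter_upwards [hreg] with n hn ω hω
  refine hstab n (p n) (X n) (β₀ n) (βhat n ω) (Rbar n) (Rhat n ω) (R₀ n) (Y n ω) hn
    (fun i => (hclus n i).abs_le_one ω) (fun i j k => ?_) hω.1.2 hω.2 hω.1.1
  -- the limiting weight is the mean of the random one, hence obeys the same bound
  rw [← (hclus n i).integral_weightM]
  have := norm_integral_le_of_norm_le_const (μ := P n) (C := c)
    (f := fun ω => weightM (X n i *ᵥ (β₀ n).ofLp) (Rbar n)⁻¹
      (resOuter (X n i *ᵥ (β₀ n).ofLp) (Y n ω i)) j k)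
    (Eventually.of_forall fun ω => hcb _ _ _ (hn.pred i) hn.entries
      ((hclus n i).abs_le_one ω) j k)
  simpa using this

end Asymptotics

end GEE

end

theorem theorem3p10
    -- one probability space for each sample size `n`
    {Ω : ℕ → Type*} [∀ n, MeasurableSpace (Ω n)] (P : ∀ n, Measure (Ω n))
    [∀ n, IsProbabilityMeasure (P n)]
    -- cluster size, number of covariates, covariates, responses, true parameter
    (m : ℕ) (p : ℕ → ℕ) (hp : ∀ n, 0 < p n)
    (X : ∀ n, Fin n → Matrix (Fin m) (Fin (p n)) ℝ)
    (Y : ∀ n, Ω n → Fin n → Fin m → ℝ)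
    (β₀ : ∀ n, EuclideanSpace ℝ (Fin (p n)))
    -- true, estimated and limiting working correlation matrix
    (R₀ : ℕ → Matrix (Fin m) (Fin m) ℝ)
    (Rhat : ∀ n, Ω n → Matrix (Fin m) (Fin m) ℝ)
    (Rbar : ℕ → Matrix (Fin m) (Fin m) ℝ)
    -- the model: binary responses, independent clusters, logistic marginal means,
    -- common correlation matrix
    (hYmeas : ∀ n i j, Measurable fun ω => Y n ω i j)
    (hYbin : ∀ n ω i j, Y n ω i j = 0 ∨ Y n ω i j = 1)
    (hYindep : ∀ n, iIndepFun (fun (i : Fin n) (ω : Ω n) => Y n ω i) (P n))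
    (hYmean : ∀ n i j, ∫ ω, Y n ω i j ∂(P n) = GEE.prob (X n i) (β₀ n) j)
    (hYcorr : ∀ n i j k,
      covariance (fun ω => Y n ω i j) (fun ω => Y n ω i k) (P n) /
        (Real.sqrt (variance (fun ω => Y n ω i j) (P n)) *
          Real.sqrt (variance (fun ω => Y n ω i k) (P n))) = R₀ n j k)
    (hRhat : ∀ n j k, Measurable fun ω => Rhat n ω j k)
    -- size of the covariates
    (hXbound : ∃ K : ℝ, ∀ᶠ n in atTop, ∀ i j,
      ‖(WithLp.toLp 2 (X n i j) : EuclideanSpace ℝ (Fin (p n)))‖ ≤ K * Real.sqrt (p n))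
    -- the parameter space and the marginal probabilities
    (B : ∀ n, Set (EuclideanSpace ℝ (Fin (p n))))
    (hBcompact : ∀ n, IsCompact (B n)) (hBint : ∀ n, β₀ n ∈ interior (B n))
    (hprob : ∃ b₁ b₂ : ℝ, 0 < b₁ ∧ b₂ < 1 ∧ ∀ᶠ n in atTop, ∀ i j,
      b₁ ≤ GEE.prob (X n i) (β₀ n) j ∧ GEE.prob (X n i) (β₀ n) j ≤ b₂)
    -- eigenvalues of the normalized design matrix
    (hdesign : ∃ b₃ b₄ : ℝ, 0 < b₃ ∧ 0 < b₄ ∧ ∀ᶠ n : ℕ in atTop,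
      spectrum ℝ ((n : ℝ)⁻¹ • ∑ i, (X n i)ᵀ * X n i) ⊆ Set.Icc b₃ b₄)
    -- eigenvalues of the correlation matrices, rate of the estimated one
    (hRtrue : ∃ c K : ℝ, 0 < c ∧ ∀ᶠ n in atTop, spectrum ℝ (R₀ n) ⊆ Set.Icc c K)
    (hRbar : ∃ c K : ℝ, 0 < c ∧ ∀ᶠ n in atTop,
      (Rbar n).PosDef ∧ spectrum ℝ (Rbar n) ⊆ Set.Icc c K)
    (hRhatRate : GEE.IsBigOp P (fun n ω => GEE.frobNorm ((Rhat n ω)⁻¹ - (Rbar n)⁻¹))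
      (fun n => Real.sqrt ((p n : ℝ) / n)))
    (hdim : Tendsto (fun n => (p n : ℝ) ^ 3 / n) atTop (𝓝 0)) :
    -- the GEE estimator exists
    (∃ βhat : ∀ n, Ω n → EuclideanSpace ℝ (Fin (p n)),
      GEE.IsGEEEstimator P X Y Rhat β₀ βhat) ∧
    -- the matrix inverted in the target exists for all large `n`
    (∀ᶠ n in atTop, IsUnit (GEE.matH (Rbar n) (X n) (β₀ n)).det) ∧
    ∀ βhat : ∀ n, Ω n → EuclideanSpace ℝ (Fin (p n)),
      GEE.IsGEEEstimator P X Y Rhat β₀ βhat →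
      -- the matrix inverted in the sandwich exists with probability tending to one
      Tendsto (fun n => P n {ω | IsUnit (GEE.matH (Rhat n ω) (X n) (βhat n ω)).det})
        atTop (𝓝 1) ∧
      ∀ (l : ℕ) (G : Matrix (Fin l) (Fin l) ℝ) (C : ∀ n, Matrix (Fin l) (Fin (p n)) ℝ),
        G.PosDef → (∀ᶠ n in atTop, C n * (C n)ᵀ = G) →
        GEE.IsLittleOp P
          (fun n ω => GEE.frobNorm
            (C n * GEE.sigmaHat (Rhat n ω) (X n) (Y n ω) (βhat n ω) * (C n)ᵀ
              - C n * GEE.sigma (Rbar n) (R₀ n) (X n) (β₀ n) * (C n)ᵀ))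
          (fun n => (n : ℝ)⁻¹) := by
  have hclus : ∀ n i, GEE.IsBinaryCluster (P n) (X n i *ᵥ (β₀ n).ofLp) (R₀ n)
      fun ω => Y n ω i := fun n i =>
    ⟨fun j => hYmeas n i j, fun ω j => hYbin n ω i j, fun j => hYmean n i j,
      fun j k => hYcorr n i j k⟩
  obtain ⟨b, b', K, L, κ, w, hb, hb', hK, hw, hreg⟩ :=
    GEE.exists_eventually_isRegular hXbound hprob hdesign hRbar
  have hdim' := GEE.tendsto_div_sqrt hp hdim
  have hR : ∀ η : ℝ, 0 < η → GEE.HighProb P fun n =>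
      {ω | GEE.frobNorm ((Rhat n ω)⁻¹ - (Rbar n)⁻¹) ≤ η} := fun η hη =>
    GEE.highProb_frobNorm_le hp hRhatRate hdim' hη
  refine ⟨GEE.exists_isGEEEstimator hp hb hb' hK hw hreg hclus hYindep hRhat hdim' hR, ?_,
    fun βhat hβ => ⟨?_, fun l G C hG hC ε hε => ?_⟩⟩
  · filter_upwards [hreg] with n hn
    have hn0 : (0 : ℝ) < n := by exact_mod_cast hn.n_pos
    have hs := GEE.sdMin_pos L
    exact (GEE.isUnit_det_and_norm_inv_le (by positivity) (hn.coercive_matH hw.le)).1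
  · exact ((GEE.highProb_norm_sigmaHat_sub hb hb' hK hw hp hreg hclus hYindep hdim' hR hβ.rate
      one_pos).mono (Eventually.of_forall fun n ω hω => hω.1)).tendsto_one
  · have htr : 0 ≤ G.trace := hG.posSemidef.trace_nonneg
    have hgood := GEE.highProb_norm_sigmaHat_sub hb hb' hK hw hp hreg hclus hYindep hdim' hR
      hβ.rate (ε := ε / (G.trace + 1)) (by positivity)
    have hsmall : GEE.HighProb P fun n => {ω | GEE.frobNorm
        (C n * GEE.sigmaHat (Rhat n ω) (X n) (Y n ω) (βhat n ω) * (C n)ᵀ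
          - C n * GEE.sigma (Rbar n) (R₀ n) (X n) (β₀ n) * (C n)ᵀ) ≤ ε * (n : ℝ)⁻¹} := by
      refine hgood.mono ?_
      filter_upwards [hC] with n hn ω hω
      rw [Set.mem_ofPred_eq, ← Matrix.sub_mul, ← Matrix.mul_sub]
      refine (GEE.frobNorm_conj_le _ _).trans ?_
      rw [hn]
      calc _ ≤ ε / (G.trace + 1) * (n : ℝ)⁻¹ * (G.trace + 1) :=
            mul_le_mul hω.2 (by linarith) htr (by positivity)
        _ = ε * (n : ℝ)⁻¹ := by field_simp
    refine tendsto_of_tendsto_of_tendsto_of_le_of_le tendsto_const_nhds hsmall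
      (fun n => zero_le) fun n => measure_mono fun ω hω => ?_
    rw [Set.mem_ofPred_eq, abs_of_nonneg (GEE.frobNorm_nonneg _)] at hω
    rw [Set.mem_compl_iff, Set.mem_ofPred_eq, not_le]
    exact hω
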